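/- Let $N\in\mathbb N$ and $1<p<q<N$, put $q^*=\frac{Nq}{N-q}$, and let $f:\mathbb R\to\mathbb R$ satisfy: $(f_1)$ $f$ is continuous and $f(t)=0$ for all $t<0$; $(f_2)$ $\lim_{|t|\to0}|f(t)|/|t|^{p-1}=0$; $(f_3)$ there is $r\in(q,q^*)$ with $\lim_{|t|\to\infty}|f(t)|/|t|^{r-1}=0$; $(f_4)$ there is $\vartheta\in(q,q^*)$ with $0<\vartheta\int_0^t f(\tau)\,d\tau\le t f(t)$ for all $t>0$; $(f_5)$ $t\mapsto f(t)/t^{q-1}$ is (not necessarily strictly) increasing on $(0,\infty)$. Let $V_0>0$ and, for $n\in\mathbb N$, let $V_n:\mathbb R^N\to\mathbb R$ be measurable with $V_n(x)\ge V_0$ for all $x$. Let $v_n$ be a positive weak solution of $$-\Delta_p v_n-\Delta_q v_n+V_n(x)\left(|v_n|^{p-2}v_n+|v_n|^{q-2}v_n\right)=f(v_n)\quad\text{in }\mathbb R^N .$$ By this we mean that $v_n>0$ a.e., that $v_n$ belongs to the energy space $$X_n=\Big\{u\in W^{1,p}(\mathbb R^N)\cap W^{1,q}(\mathbb R^N):\int_{\mathbb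 R^N}V_n(|u|^p+|u|^q)\,dx<\infty\Big\},$$ and that for every $\varphi\in X_n$ $$\int_{\mathbb R^N}|\nabla v_n|^{p-2}\nabla v_n\cdot\nabla\varphi\,dx+\int_{\mathbb R^N}|\nabla v_n|^{q-2}\nabla v_n\cdot\nabla\varphi\,dx+\int_{\mathbb R^N}V_n\left(|v_n|^{p-2}v_n+|v_n|^{q-2}v_n\right)\varphi\,dx=\int_{\mathbb R^N}f(v_n)\varphi\,dx .$$ Suppose that $v_n\to v$ in $W^{1,p}(\mathbb R^N)\cap W^{1,q}(\mathbb R^N)$ for some $v\in W^{1,p}(\mathbb R^N)\cap W^{1,q}(\mathbb R^N)$ with $v\not\equiv0$. Then $v_n\in L^\infty(\mathbb R^N)$ for every $n$, and there is $C>0$ such that $|v_n|_{L^\infty(\mathbb R^N)}\le C$ for all $n\in\mathbb N$. Moreover, $v_n(x)\to0$ as $|x|\to\infty$ uniformly in $n$: for every $\epsilon>0$ there is $R>0$ such that, for all $n\in\mathbb N$, $|v_n(x)|\le\epsilon$ for almost every $x$ with $|x|\ge R$. -/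

import Mathlib

open MeasureTheory Filter Topology
open scoped ENNReal ContDiff

noncomputable section

namespace PQLaplace

/-- `ℝᴺ` with its Euclidean norm. -/
abbrev E (N : ℕ) : Type := EuclideanSpace ℝ (Fin N)

/-- `G` is a weak (distributional) gradient of `u` on `ℝᴺ`: for every test function `φ ∈ C_c^∞` and
every direction `w`, one has `∫ u ∂_w φ = - ∫ (G · w) φ`. -/
structure IsWeakGradient {N : ℕ} (u : E N → ℝ) (G : E N → E N) : Prop where
  locallyIntegrable : LocallyIntegrable u
  locallyIntegrable_grad : LocallyIntegrable G
  integral_eq : ∀ φ : E N → ℝ, ContDiff ℝ ∞ φ → HasCompactSupport φ → ∀ w : E N,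
    ∫ x, u x * fderiv ℝ φ x w = - ∫ x, inner ℝ (G x) w * φ x

open Classical in
/-- The weak gradient `∇u` (unique up to null sets); it is `0` if `u` has no weak gradient. -/
def weakGrad {N : ℕ} (u : E N → ℝ) : E N → E N :=
  if h : ∃ G, IsWeakGradient u G then h.choose else 0

theorem IsWeakGradient.weakGrad {N : ℕ} {u : E N → ℝ} {G : E N → E N} (h : IsWeakGradient u G) :
    IsWeakGradient u (weakGrad u) := by
  have h' : ∃ G, IsWeakGradient u G := ⟨G, h⟩
  rw [PQLaplace.weakGrad, dif_pos h']
  exact h'.choose_spec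

/-- `u ∈ W^{1,s}(ℝᴺ)`: `u` and its weak gradient, which exists, are in `L^s`. -/
structure MemW1 {N : ℕ} (s : ℝ) (u : E N → ℝ) : Prop where
  memLp : MemLp u (ENNReal.ofReal s)
  isWeakGradient : IsWeakGradient u (weakGrad u)
  memLp_grad : MemLp (weakGrad u) (ENNReal.ofReal s)

/-- The norm of `W^{1,s}(ℝᴺ)`: `‖u‖_{1,s}^s = |∇u|_s^s + |u|_s^s`. -/
def w1Norm {N : ℕ} (s : ℝ) (u : E N → ℝ) : ℝ≥0∞ :=
  (eLpNorm (weakGrad u) (ENNReal.ofReal s) volume ^ s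
    + eLpNorm u (ENNReal.ofReal s) volume ^ s) ^ (1 / s)

/-- The energy space `{u ∈ W^{1,p} ∩ W^{1,q} : ∫ V (|u|^p + |u|^q) < ∞}` of a potential `V`. -/
structure MemEnergySpace {N : ℕ} (p q : ℝ) (V : E N → ℝ) (u : E N → ℝ) : Prop where
  memW1_p : MemW1 p u
  memW1_q : MemW1 q u
  integrable_potential : Integrable (fun x => V x * (|u x| ^ p + |u x| ^ q))

/-- `u` is a positive weak solution of
`-Δ_p u - Δ_q u + V(x) (|u|^{p-2} u + |u|^{q-2} u) = f(u)` in `ℝᴺ`: it lies in the energy space, is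
positive almost everywhere, and satisfies the integrated equation for all test functions in the
energy space, that is, it is a critical point of the energy functional. -/
structure IsPositiveWeakSolution {N : ℕ} (p q : ℝ) (V : E N → ℝ) (f : ℝ → ℝ) (u : E N → ℝ) :
    Prop where
  mem : MemEnergySpace p q V u
  pos : ∀ᵐ x, 0 < u x
  equation : ∀ φ : E N → ℝ, MemEnergySpace p q V φ →
    (∫ x, ‖weakGrad u x‖ ^ (p - 2) * inner ℝ (weakGrad u x) (weakGrad φ x))
      + (∫ x, ‖weakGrad u x‖ ^ (q - 2) * inner ℝ (weakGrad u x) (weakGrad φ x))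
      + (∫ x, V x * (|u x| ^ (p - 2) * u x + |u x| ^ (q - 2) * u x) * φ x)
      = ∫ x, f (u x) * φ x

/-- The critical Sobolev exponent `q* = N q / (N - q)`, used for `q < N`. -/
def critExp (N : ℕ) (q : ℝ) : ℝ := N * q / (N - q)

/-- The structural conditions on the nonlinearity `f`. -/
structure Nonlinearity (N : ℕ) (p q : ℝ) (f : ℝ → ℝ) : Prop where
  continuous : Continuous f
  eq_zero_of_neg : ∀ t < 0, f t = 0
  lim_zero : Tendsto (fun t : ℝ => |f t| / |t| ^ (p - 1)) (𝓝[≠] 0) (𝓝 0)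
  subcritical : ∃ r : ℝ, q < r ∧ r < critExp N q ∧
    Tendsto (fun t : ℝ => |f t| / |t| ^ (r - 1)) (cocompact ℝ) (𝓝 0)
  superlinear : ∃ θ : ℝ, q < θ ∧ θ < critExp N q ∧ ∀ t : ℝ, 0 < t →
    0 < θ * (∫ τ in (0 : ℝ)..t, f τ) ∧ θ * (∫ τ in (0 : ℝ)..t, f τ) ≤ t * f t
  monotone : MonotoneOn (fun t : ℝ => f t / t ^ (q - 1)) (Set.Ioi 0)

end PQLaplace

end

namespace PQLaplace

/-! ### Local integrability and derivatives of test functions -/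

variable {N : ℕ}

/-! The proof is De Giorgi's level-set iteration with constants that see `V n` only through the
bound `V₀ ≤ V n`, so that every estimate is uniform in `n`.

By `exists_growth_bound`, `|f t| ≤ V₀ t^(p-1) + C t^(r-1)` for `t > 0`. The first term is absorbed
by the potential; only the subcritical power remains. Testing the equation with `(u - k - h)⁺ ζ`,
where `|∇ζ| ≤ K ζ^(1-1/q)`, gives a Caccioppoli estimate (`energy_truncTest_le`): the `W^{1,q}`
energy of the test function is at most a constant times `Λ^r ∫_{ζ>0} ((u - k)⁺)^r`. All lower powers
fit into the `r`-th one because `(u - k)⁺ ≥ h` wherever `u > k + h`, and `Λ h ≥ 1`. Sobolev's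
inequality then raises the integrability to `q*`, and giving up a second gap `h` returns to the
exponent `r` (`exists_deGiorgi_step`). The outcome is a recursion `U (j+1) ≤ c b^j (U j)^(q*/q)`
with `q*/q > 1`, which forces `U j → 0` as soon as `U 0` is below a threshold
(`exists_deGiorgi_threshold`).

The threshold is reached in two ways. With `ζ = 1` and a high level `L`, `U 0 ≤ L^(-(q*-r)) ∫ |v
n|^(q*)`, which is small uniformly in `n` because `r < q*` and the sequence is bounded in `L^(q*)`;
this is the uniform bound. With exterior cutoffs and level `ε`, `U 0` is at most the `L^r` tail of
`v n` outside a ball, which is uniformly small because a convergent sequence is tight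
(`exists_uniform_tail`); this is the uniform decay.

The groundwork is calculus for weak gradients by mollification: the product rule, the gradient of a
truncation (`IsWeakGradient.posPart_sub`) and Sobolev's inequality (`exists_sobolev_const`). -/

theorem locallyIntegrable_continuous_smul {F : Type*} [NormedAddCommGroup F] [NormedSpace ℝ F]
    {f : E N → F} (hf : LocallyIntegrable f) {g : E N → ℝ} (hg : Continuous g) :
    LocallyIntegrable (fun x => g x • f x) := by
  rw [← locallyIntegrableOn_univ] at hf ⊢
  exact hf.continuousOn_smul isOpen_univ.isLocallyClosed hg.continuousOn

theorem locallyIntegrable_smul_continuous {F : Type*} [NormedAddCommGroup F] [NormedSpace ℝ F]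
    {f : E N → ℝ} (hf : LocallyIntegrable f) {g : E N → F} (hg : Continuous g) :
    LocallyIntegrable (fun x => f x • g x) := by
  rw [← locallyIntegrableOn_univ] at hf ⊢
  exact hf.smul_continuousOn isOpen_univ.isLocallyClosed hg.continuousOn

theorem LocallyIntegrable.inner_const {G : E N → E N} (hG : LocallyIntegrable G) (w : E N) :
    LocallyIntegrable (fun x => inner ℝ (G x) w) := by
  intro x
  obtain ⟨s, hs, h⟩ := hG x
  exact ⟨s, hs, Integrable.inner_const (𝕜 := ℝ) h w⟩

theorem continuous_fderiv_apply {φ : E N → ℝ} (hφ : ContDiff ℝ ∞ φ) (w : E N) :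
    Continuous fun x => fderiv ℝ φ x w :=
  (hφ.continuous_fderiv (by simp)).clm_apply continuous_const

theorem hasCompactSupport_fderiv_apply {φ : E N → ℝ} (hφ : HasCompactSupport φ) (w : E N) :
    HasCompactSupport fun x => fderiv ℝ φ x w :=
  hφ.fderiv_apply ℝ w

theorem inner_gradient (φ : E N → ℝ) (x w : E N) : inner ℝ (gradient φ x) w = fderiv ℝ φ x w := by
  rw [← InnerProductSpace.toDual_apply_apply (𝕜 := ℝ), toDual_gradient]

theorem norm_gradient (φ : E N → ℝ) (x : E N) : ‖gradient φ x‖ = ‖fderiv ℝ φ x‖ := by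
  rw [← toDual_gradient, LinearIsometryEquiv.norm_map]

theorem continuous_gradient {φ : E N → ℝ} (hφ : ContDiff ℝ ∞ φ) : Continuous (gradient φ) :=
  (InnerProductSpace.toDual ℝ (E N)).symm.continuous.comp (hφ.continuous_fderiv (by simp))

/-! ### Weak gradients: uniqueness, differences, products -/

namespace IsWeakGradient

variable {u : E N → ℝ} {G : E N → E N}

theorem integrable_mul (h : IsWeakGradient u G) {φ : E N → ℝ} (hφ : Continuous φ)
    (hc : HasCompactSupport φ) : Integrable fun x => u x * φ x :=
  h.locallyIntegrable.integrable_smul_right_of_hasCompactSupport hφ hc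

theorem integrable_inner_mul (h : IsWeakGradient u G) {φ : E N → ℝ} (hφ : Continuous φ)
    (hc : HasCompactSupport φ) (w : E N) : Integrable fun x => inner ℝ (G x) w * φ x :=
  (LocallyIntegrable.inner_const h.locallyIntegrable_grad
    w).integrable_smul_right_of_hasCompactSupport hφ hc

/-- The defining identity fixes the integral of `φ ⟨w, G⟩` for all `φ` and `w`, so the fundamental
lemma of the calculus of variations applies. It is needed because `weakGrad` is an arbitrary choice,
known only through this uniqueness. -/
theorem ae_eq (h : IsWeakGradient u G) {G' : E N → E N} (h' : IsWeakGradient u G') :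
    G =ᵐ[volume] G' := by
  refine ae_eq_of_integral_contDiff_smul_eq h.locallyIntegrable_grad h'.locallyIntegrable_grad ?_
  intro φ hφ hc
  refine ext_inner_left ℝ fun w => ?_
  rw [← integral_inner
      (h.locallyIntegrable_grad.integrable_smul_left_of_hasCompactSupport hφ.continuous hc),
    ← integral_inner
      (h'.locallyIntegrable_grad.integrable_smul_left_of_hasCompactSupport hφ.continuous hc)]
  have h1 := h.integral_eq φ hφ hc w
  rw [h'.integral_eq φ hφ hc w, neg_inj] at h1
  simp only [real_inner_smul_right]
  have e : ∀ H : E N → E N, ∫ x, φ x * inner ℝ w (H x) = ∫ x, inner ℝ (H x) w * φ x := fun H => by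
    congr 1 with x
    rw [real_inner_comm, mul_comm]
  rw [e, e, h1]

theorem weakGrad_ae_eq (h : IsWeakGradient u G) : PQLaplace.weakGrad u =ᵐ[volume] G :=
  h.weakGrad.ae_eq h

theorem sub (h : IsWeakGradient u G) {u' : E N → ℝ} {G' : E N → E N}
    (h' : IsWeakGradient u' G') : IsWeakGradient (u - u') (G - G') where
  locallyIntegrable := h.locallyIntegrable.sub h'.locallyIntegrable
  locallyIntegrable_grad := h.locallyIntegrable_grad.sub h'.locallyIntegrable_grad
  integral_eq φ hφ hc w := by
    have c1 := continuous_fderiv_apply hφ w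
    have c2 := hasCompactSupport_fderiv_apply hc w
    simp only [Pi.sub_apply, sub_mul, inner_sub_left]
    rw [integral_sub (h.integrable_mul c1 c2) (h'.integrable_mul c1 c2),
      integral_sub (h.integrable_inner_mul hφ.continuous hc w)
        (h'.integrable_inner_mul hφ.continuous hc w),
      h.integral_eq φ hφ hc w, h'.integral_eq φ hφ hc w]
    ring

/-- Testing `u` with `ζ φ`, which is again a test function, and expanding its derivative gives the
product rule; `ζ` itself needs no compact support. -/
theorem mul_contDiff (h : IsWeakGradient u G) {ζ : E N → ℝ} (hζ : ContDiff ℝ ∞ ζ) :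
    IsWeakGradient (fun x => u x * ζ x) (fun x => ζ x • G x + u x • gradient ζ x) where
  locallyIntegrable := locallyIntegrable_smul_continuous h.locallyIntegrable hζ.continuous
  locallyIntegrable_grad :=
    (locallyIntegrable_continuous_smul h.locallyIntegrable_grad hζ.continuous).add
      (locallyIntegrable_smul_continuous h.locallyIntegrable (continuous_gradient hζ))
  integral_eq φ hφ hc w := by
    have hd : ∀ x, fderiv ℝ (fun x => ζ x * φ x) x w
        = ζ x * fderiv ℝ φ x w + fderiv ℝ ζ x w * φ x := by
      intro x
      rw [fderiv_fun_mul (hζ.differentiable (by simp) x) (hφ.differentiable (by simp) x)]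
      simp [mul_comm]
    have h1 := h.integral_eq (fun x => ζ x * φ x) (hζ.mul hφ) hc.mul_left w
    have i1 : Integrable fun x => u x * (ζ x * fderiv ℝ φ x w) :=
      h.integrable_mul (hζ.continuous.mul (continuous_fderiv_apply hφ w))
        (hasCompactSupport_fderiv_apply hc w).mul_left
    have i2 : Integrable fun x => u x * (fderiv ℝ ζ x w * φ x) :=
      h.integrable_mul ((continuous_fderiv_apply hζ w).mul hφ.continuous) hc.mul_left
    have i3 : Integrable fun x => inner ℝ (G x) w * (ζ x * φ x) :=
      h.integrable_inner_mul (hζ.continuous.mul hφ.continuous) hc.mul_left w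
    simp only [hd, mul_add] at h1
    rw [integral_add i1 i2] at h1
    have e1 : ∫ x, u x * ζ x * fderiv ℝ φ x w = ∫ x, u x * (ζ x * fderiv ℝ φ x w) := by
      simp only [mul_assoc]
    have e2 : ∫ x, inner ℝ (ζ x • G x + u x • gradient ζ x) w * φ x
        = (∫ x, inner ℝ (G x) w * (ζ x * φ x)) + ∫ x, u x * (fderiv ℝ ζ x w * φ x) := by
      rw [← integral_add i3 i2]
      congr 1 with x
      rw [inner_add_left, real_inner_smul_left, real_inner_smul_left, inner_gradient]
      ring
    rw [e1, e2]
    linarith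

end IsWeakGradient

theorem MemW1.of_isWeakGradient {s : ℝ} {u : E N → ℝ} {G : E N → E N} (h : IsWeakGradient u G)
    (hu : MemLp u (ENNReal.ofReal s)) (hG : MemLp G (ENNReal.ofReal s)) : MemW1 s u :=
  ⟨hu, h.weakGrad, hG.ae_eq h.weakGrad_ae_eq.symm⟩

theorem MemW1.sub {s : ℝ} {u v : E N → ℝ} (hu : MemW1 s u) (hv : MemW1 s v) : MemW1 s (u - v) :=
  .of_isWeakGradient (hu.isWeakGradient.sub hv.isWeakGradient) (hu.memLp.sub hv.memLp)
    (hu.memLp_grad.sub hv.memLp_grad)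

/-! ### Mollification -/

open scoped Convolution in
/-- Convolution of `g` with a normalized bump function. -/
noncomputable def mollify {F : Type*} [NormedAddCommGroup F] [NormedSpace ℝ F]
    (φ : ContDiffBump (0 : E N)) (g : E N → F) : E N → F :=
  φ.normed volume ⋆[ContinuousLinearMap.lsmul ℝ ℝ, volume] g

section

variable {F : Type*} [NormedAddCommGroup F] [NormedSpace ℝ F]

theorem mollify_apply (φ : ContDiffBump (0 : E N)) (g : E N → F) (x : E N) :
    mollify φ g x = ∫ t, φ.normed volume t • g (x - t) := rfl

theorem mollify_apply_swap (φ : ContDiffBump (0 : E N)) (g : E N → F) (x : E N) :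
    mollify φ g x = ∫ t, φ.normed volume (x - t) • g t :=
  convolution_lsmul_swap

theorem mollify_congr (φ : ContDiffBump (0 : E N)) {g g' : E N → F} (h : g =ᵐ[volume] g') :
    mollify φ g = mollify φ g' :=
  convolution_congr _ EventuallyEq.rfl h

theorem mollify_sub (φ : ContDiffBump (0 : E N)) {g g' : E N → F} (h : LocallyIntegrable g)
    (h' : LocallyIntegrable g') : mollify φ (g - g') = mollify φ g - mollify φ g' := by
  have e := fun (f : E N → F) (hf : LocallyIntegrable f) =>
    (φ.hasCompactSupport_normed (μ := volume)).convolutionExists_left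
      (ContinuousLinearMap.lsmul ℝ ℝ) (μ := volume) φ.continuous_normed hf
  ext x
  simp only [mollify_apply, Pi.sub_apply, smul_sub]
  exact integral_sub (e g h x) (e g' h' x)

theorem continuous_mollify (φ : ContDiffBump (0 : E N)) {g : E N → F} (h : LocallyIntegrable g) :
    Continuous (mollify φ g) :=
  φ.hasCompactSupport_normed.continuous_convolution_left _ φ.continuous_normed h

theorem contDiff_mollify (φ : ContDiffBump (0 : E N)) {g : E N → F} (h : LocallyIntegrable g) :
    ContDiff ℝ ∞ (mollify φ g) :=
  φ.hasCompactSupport_normed.contDiff_convolution_left _ φ.contDiff_normed h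

/-- A mollification averages translates of `g` against a probability measure: Jensen bounds the
`s`-th power pointwise, then Tonelli and translation invariance give the contraction. -/
theorem eLpNorm_mollify_le (φ : ContDiffBump (0 : E N)) {g : E N → F}
    (hg : AEStronglyMeasurable g) {s : ℝ} (hs : 1 ≤ s) :
    eLpNorm (mollify φ g) (ENNReal.ofReal s) ≤ eLpNorm g (ENNReal.ofReal s) := by
  have s0 : 0 < s := by linarith
  -- Mollification ignores null sets, so `g` may be replaced by a strongly measurable
  -- representative, for which Tonelli applies.
  rw [mollify_congr φ hg.ae_eq_mk, eLpNorm_congr_ae hg.ae_eq_mk]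
  have hm : StronglyMeasurable (hg.mk g) := hg.stronglyMeasurable_mk
  generalize hg.mk g = g at hm
  set ν : Measure (E N) := volume.withDensity fun t => ‖φ.normed volume t‖ₑ with hν
  have mρ : Measurable fun t : E N => ‖φ.normed volume t‖ₑ :=
    (φ.continuous_normed (μ := volume)).measurable.enorm
  have : IsProbabilityMeasure ν := ⟨by
    rw [hν, withDensity_apply _ MeasurableSet.univ, setLIntegral_univ,
      ← ofReal_integral_norm_eq_lintegral_enorm φ.integrable_normed]
    simp [abs_of_nonneg (φ.nonneg_normed _), φ.integral_normed]⟩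
  have hne : ENNReal.ofReal s ≠ 0 := by simpa using s0
  rw [eLpNorm_eq_lintegral_rpow_enorm_toReal hne ENNReal.ofReal_ne_top,
    eLpNorm_eq_lintegral_rpow_enorm_toReal hne ENNReal.ofReal_ne_top, ENNReal.toReal_ofReal s0.le]
  gcongr ?_ ^ _
  have key : ∀ x, ‖mollify φ g x‖ₑ ^ s ≤ ∫⁻ t, ‖g (x - t)‖ₑ ^ s ∂ν := by
    intro x
    have h1 : ‖mollify φ g x‖ₑ ≤ ∫⁻ t, ‖g (x - t)‖ₑ ∂ν := by
      have hm' : Measurable fun t => ‖g (x - t)‖ₑ :=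
        (hm.comp_measurable (measurable_const.sub measurable_id)).enorm
      rw [mollify_apply, hν, lintegral_withDensity_eq_lintegral_mul _ mρ hm']
      refine (enorm_integral_le_lintegral_enorm _).trans (lintegral_mono fun t => ?_)
      simp [enorm_smul]
    have h2 := eLpNorm'_le_eLpNorm'_of_exponent_le (p := 1) (q := s) one_pos hs ν
      (f := fun t => g (x - t))
      (hm.comp_measurable (measurable_const.sub measurable_id)).aestronglyMeasurable
    simp only [eLpNorm', ENNReal.rpow_one, div_one] at h2
    calc ‖mollify φ g x‖ₑ ^ s ≤ ((∫⁻ t, ‖g (x - t)‖ₑ ^ s ∂ν) ^ (1 / s)) ^ s := by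
          gcongr; exact h1.trans h2
      _ = _ := by rw [← ENNReal.rpow_mul, one_div_mul_cancel s0.ne', ENNReal.rpow_one]
  calc ∫⁻ x, ‖mollify φ g x‖ₑ ^ s ≤ ∫⁻ x, ∫⁻ t, ‖g (x - t)‖ₑ ^ s ∂ν := lintegral_mono key
    _ = ∫⁻ t, (∫⁻ x, ‖g (x - t)‖ₑ ^ s) ∂ν := by
      refine lintegral_lintegral_swap (Measurable.aemeasurable ?_)
      exact ((hm.comp_measurable (measurable_fst.sub measurable_snd)).enorm).pow_const s
    _ = ∫⁻ t, (∫⁻ x, ‖g x‖ₑ ^ s) ∂ν := by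
      congr 1 with t
      exact lintegral_sub_right_eq_self (fun x => ‖g x‖ₑ ^ s) t
    _ = ∫⁻ x, ‖g x‖ₑ ^ s := by simp

theorem tendstoUniformly_mollify [CompleteSpace F] {φ : ℕ → ContDiffBump (0 : E N)}
    (hφ : Tendsto (fun n => (φ n).rOut) atTop (𝓝 0)) {g : E N → F} (hg : Continuous g)
    (hc : HasCompactSupport g) : TendstoUniformly (fun n => mollify (φ n) g) g atTop := by
  rw [Metric.tendstoUniformly_iff]
  intro ε hε
  obtain ⟨δ, hδ, h⟩ := Metric.uniformContinuous_iff.1 (hc.uniformContinuous_of_continuous hg)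
    (ε / 2) (by positivity)
  filter_upwards [hφ.eventually (gt_mem_nhds hδ)] with n hn x
  rw [dist_comm]
  refine lt_of_le_of_lt ((φ n).dist_normed_convolution_le hg.aestronglyMeasurable
    fun y hy => (h ?_).le) (half_lt_self hε)
  exact (Metric.mem_ball.1 hy).trans hn

/-- Approximate `g` in `L^s` by a continuous compactly supported `g₀`. The mollifications of `g₀`
converge uniformly, hence in `L^s(K)`, and contractivity controls those of `g - g₀`. -/
theorem tendsto_eLpNorm_mollify_sub [CompleteSpace F] {φ : ℕ → ContDiffBump (0 : E N)}
    (hφ : Tendsto (fun n => (φ n).rOut) atTop (𝓝 0)) {g : E N → F} {s : ℝ} (hs : 1 ≤ s)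
    (hg : MemLp g (ENNReal.ofReal s)) {K : Set (E N)} (hK : IsCompact K) :
    Tendsto (fun n => eLpNorm (mollify (φ n) g - g) (ENNReal.ofReal s) (volume.restrict K)) atTop
      (𝓝 0) := by
  have hs' : 1 ≤ ENNReal.ofReal s := by simpa using hs
  have hli := hg.locallyIntegrable hs'
  rw [ENNReal.tendsto_atTop_zero]
  intro ε hε
  have hε3 : ε / 3 ≠ 0 := by simpa using hε.ne'
  obtain ⟨g₀, hc, hle, hcont, hmem⟩ :=
    hg.exists_hasCompactSupport_eLpNorm_sub_le ENNReal.ofReal_ne_top hε3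
  have hli₀ := hmem.locallyIntegrable hs'
  have hunif : Tendsto (fun n => eLpNorm (mollify (φ n) g₀ - g₀) (ENNReal.ofReal s)
      (volume.restrict K)) atTop (𝓝 0) := by
    have hV : volume K ^ (1 / s) ≠ ⊤ :=
      ENNReal.rpow_ne_top_of_nonneg (by positivity) hK.measure_lt_top.ne
    rw [ENNReal.tendsto_atTop_zero]
    intro η hη
    obtain ⟨c, hc0, hc1⟩ : ∃ c : ℝ, 0 < c ∧ volume K ^ (1 / s) * ENNReal.ofReal c ≤ η := by
      have : Tendsto (fun c : ℝ => volume K ^ (1 / s) * ENNReal.ofReal c) (𝓝[>] 0) (𝓝 0) := by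
        have h0 : Tendsto (fun c : ℝ => ENNReal.ofReal c) (𝓝[>] 0) (𝓝 0) := by
          simpa using (ENNReal.continuous_ofReal.tendsto 0).mono_left nhdsWithin_le_nhds
        simpa using ENNReal.Tendsto.const_mul h0 (Or.inr hV)
      obtain ⟨c, h1, h2⟩ := ((this.eventually (ge_mem_nhds hη)).and self_mem_nhdsWithin).exists
      exact ⟨c, h2, h1⟩
    obtain ⟨n₀, hn₀⟩ := eventually_atTop.1
      (Metric.tendstoUniformly_iff.1 (tendstoUniformly_mollify hφ hcont hc) c hc0)
    refine ⟨n₀, fun n hn => le_trans ?_ hc1⟩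
    refine (eLpNorm_le_of_ae_bound (C := c) (Eventually.of_forall fun x => ?_)).trans ?_
    · rw [Pi.sub_apply, ← dist_eq_norm, dist_comm]
      exact (hn₀ n hn x).le
    · rw [ENNReal.toReal_ofReal (by linarith)]
      simp
  obtain ⟨n₀, hn₀⟩ := ENNReal.tendsto_atTop_zero.1 hunif (ε / 3) (pos_iff_ne_zero.2 hε3)
  refine ⟨n₀, fun n hn => ?_⟩
  have hdec : mollify (φ n) g - g
      = mollify (φ n) (g - g₀) + ((mollify (φ n) g₀ - g₀) + (g₀ - g)) := by
    rw [mollify_sub _ hli hli₀]; abel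
  have m1 : AEStronglyMeasurable (mollify (φ n) (g - g₀)) (volume.restrict K) :=
    (continuous_mollify _ (hli.sub hli₀)).aestronglyMeasurable
  have m2 : AEStronglyMeasurable (mollify (φ n) g₀ - g₀) (volume.restrict K) :=
    ((continuous_mollify _ hli₀).sub hcont).aestronglyMeasurable
  have m3 : AEStronglyMeasurable (g₀ - g) (volume.restrict K) :=
    (hmem.1.sub hg.1).restrict
  rw [hdec]
  calc _ ≤ ε / 3 + (ε / 3 + ε / 3) := by
        refine (eLpNorm_add_le m1 (m2.add m3) hs').trans (add_le_add ?_ ?_)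
        · exact (eLpNorm_mono_measure _ Measure.restrict_le_self).trans
            ((eLpNorm_mollify_le _ (hg.1.sub hmem.1) hs).trans hle)
        · refine (eLpNorm_add_le m2 m3 hs').trans (add_le_add (hn₀ n hn) ?_)
          rw [eLpNorm_sub_comm]
          exact (eLpNorm_mono_measure _ Measure.restrict_le_self).trans hle
    _ = ε := by rw [← add_assoc]; exact ENNReal.add_thirds ε

theorem tendsto_integral_norm_mollify_sub [CompleteSpace F] {φ : ℕ → ContDiffBump (0 : E N)}
    (hφ : Tendsto (fun n => (φ n).rOut) atTop (𝓝 0)) {g : E N → F} {s : ℝ} (hs : 1 ≤ s)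
    (hg : MemLp g (ENNReal.ofReal s)) {K : Set (E N)} (hK : IsCompact K) :
    Tendsto (fun n => ∫ x in K, ‖mollify (φ n) g x - g x‖) atTop (𝓝 0) := by
  have hs' : 1 ≤ ENNReal.ofReal s := by simpa using hs
  have hli := hg.locallyIntegrable hs'
  have hm : ∀ n, AEStronglyMeasurable (mollify (φ n) g - g) (volume.restrict K) := fun n =>
    (continuous_mollify _ hli).aestronglyMeasurable.sub hg.1.restrict
  set c := volume.restrict K Set.univ ^ (1 / (1 : ℝ≥0∞).toReal - 1 / (ENNReal.ofReal s).toReal)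
  have hc : c ≠ ⊤ := by
    refine ENNReal.rpow_ne_top_of_nonneg ?_
      (by rw [Measure.restrict_apply_univ]; exact hK.measure_lt_top.ne)
    rw [ENNReal.toReal_ofReal (by linarith), ENNReal.toReal_one, sub_nonneg]
    exact one_div_le_one_div_of_le one_pos hs
  have h1 : Tendsto (fun n => eLpNorm (mollify (φ n) g - g) 1 (volume.restrict K)) atTop (𝓝 0) := by
    have h2 := ENNReal.Tendsto.mul_const (tendsto_eLpNorm_mollify_sub hφ hs hg hK)
      (Or.inr hc)
    rw [zero_mul] at h2
    exact tendsto_of_tendsto_of_tendsto_of_le_of_le tendsto_const_nhds h2 (fun _ => zero_le)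
      fun n => eLpNorm_le_eLpNorm_mul_rpow_measure_univ hs' (hm n)
  have h2 := (ENNReal.tendsto_toReal ENNReal.zero_ne_top).comp h1
  rw [ENNReal.toReal_zero] at h2
  refine h2.congr fun n => ?_
  rw [Function.comp_apply, eLpNorm_one_eq_lintegral_enorm]
  exact (integral_norm_eq_lintegral_enorm (hm n)).symm

end

/-- The derivative falls on the kernel, and `y ↦ ρ(x - y)` is an admissible test function; its
reflection supplies the sign that cancels the one in the weak identity. -/
theorem IsWeakGradient.fderiv_mollify {u : E N → ℝ} {G : E N → E N} (h : IsWeakGradient u G)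
    (φ : ContDiffBump (0 : E N)) (x w : E N) :
    fderiv ℝ (mollify φ u) x w = inner ℝ (mollify φ G x) w := by
  have hd : ContDiff ℝ ∞ (φ.normed (volume : Measure (E N))) := φ.contDiff_normed
  have hcs : HasCompactSupport (φ.normed (volume : Measure (E N))) := φ.hasCompactSupport_normed
  have h1 := (hcs.hasFDerivAt_convolution_left (𝕜 := ℝ) (ContinuousLinearMap.lsmul ℝ ℝ)
    (hd.of_le (by simp)) h.locallyIntegrable x).fderiv
  set ψ : E N → ℝ := fun y => φ.normed volume (x - y) with hψ
  have hψd : ContDiff ℝ ∞ ψ := hd.comp (contDiff_const.sub contDiff_id)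
  have hψc : HasCompactSupport ψ := hcs.comp_homeomorph (Homeomorph.subLeft x)
  have hfd : ∀ y, fderiv ℝ ψ y w = - fderiv ℝ (φ.normed volume) (x - y) w := by
    intro y
    have := ((hd.differentiable (by simp) (x - y)).hasFDerivAt.comp y
      ((hasFDerivAt_id y).const_sub x)).fderiv
    have e : fderiv ℝ ψ y = _ := this
    rw [e]; simp
  have h2 := h.integral_eq ψ hψd hψc w
  have h3 : fderiv ℝ (mollify φ u) x w = ∫ y, fderiv ℝ (φ.normed volume) (x - y) w * u y := by
    have e : fderiv ℝ (mollify φ u) x = _ := h1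
    rw [e, convolution_eq_swap, ContinuousLinearMap.integral_apply]
    · rfl
    · exact ((hcs.fderiv (𝕜 := ℝ)).convolutionExists_left _ (hd.continuous_fderiv (by simp))
        h.locallyIntegrable x).integrable_swap
  rw [h3, mollify_apply_swap, real_inner_comm, ← integral_inner]
  · simp only [hfd, mul_neg, integral_neg, neg_inj] at h2
    simp only [real_inner_smul_right]
    have e1 : ∀ y, fderiv ℝ (φ.normed volume) (x - y) w * u y
      = u y * fderiv ℝ (φ.normed volume) (x - y) w := fun y => mul_comm _ _
    have e2 : ∀ y, φ.normed volume (x - y) * inner ℝ w (G y) = inner ℝ (G y) w * ψ y := fun y => by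
      rw [real_inner_comm, mul_comm]
    simp only [e1, e2, h2]
  · exact (hcs.convolutionExists_left (ContinuousLinearMap.lsmul ℝ ℝ) hd.continuous
        h.locallyIntegrable_grad x).integrable_swap

/-- A sequence of bump functions shrinking to the origin. -/
noncomputable def shrinkingBump (N n : ℕ) : ContDiffBump (0 : E N) where
  rIn := 1 / (n + 1)
  rOut := 2 / (n + 1)
  rIn_pos := by positivity
  rIn_lt_rOut := by gcongr; norm_num

theorem tendsto_shrinkingBump_rOut (N : ℕ) :
    Tendsto (fun n => (shrinkingBump N n).rOut) atTop (𝓝 0) := by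
  have := (tendsto_one_div_add_atTop_nhds_zero_nat (𝕜 := ℝ)).const_mul 2
  rw [mul_zero] at this
  exact this.congr fun n => by simp [shrinkingBump, div_eq_mul_inv]

/-- Lebesgue differentiation requires the ratio of outer to inner radius to stay bounded; here it is
always `2`. -/
theorem ae_tendsto_mollify_shrinkingBump {F : Type*} [NormedAddCommGroup F] [NormedSpace ℝ F]
    [CompleteSpace F] {g : E N → F} (hg : LocallyIntegrable g) :
    ∀ᵐ x, Tendsto (fun n => mollify (shrinkingBump N n) g x) atTop (𝓝 (g x)) :=
  ContDiffBump.ae_convolution_tendsto_right_of_locallyIntegrable (K := 2)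
    (tendsto_shrinkingBump_rOut N)
    (Eventually.of_forall fun n => by simp [shrinkingBump, div_eq_mul_inv]) hg

/-! ### Chain rule and truncation -/

theorem tendsto_integral_mul_sub_of_bounded {a : ℕ → E N → ℝ} {g : ℕ → E N → ℝ} {g₀ : E N → ℝ}
    {K : Set (E N)} {B : ℝ} (ha : ∀ n x, |a n x| ≤ B)
    (ha0 : ∀ n, ∀ x ∉ K, a n x = 0) (hg : ∀ n, IntegrableOn (fun x => g n x - g₀ x) K)
    (h : Tendsto (fun n => ∫ x in K, |g n x - g₀ x|) atTop (𝓝 0)) :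
    Tendsto (fun n => ∫ x, a n x * (g n x - g₀ x)) atTop (𝓝 0) := by
  have h' := h.const_mul B
  rw [mul_zero] at h'
  refine squeeze_zero_norm (fun n => ?_) h'
  have e : ∫ x, a n x * (g n x - g₀ x) = ∫ x in K, a n x * (g n x - g₀ x) := by
    refine (setIntegral_eq_integral_of_forall_compl_eq_zero fun x hx => ?_).symm
    rw [ha0 n x hx, zero_mul]
  rw [e, ← integral_const_mul]
  refine norm_integral_le_of_norm_le ((hg n).abs.const_mul B) (Eventually.of_forall fun x => ?_)
  rw [norm_mul, Real.norm_eq_abs, Real.norm_eq_abs]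
  gcongr
  exact ha n x

theorem exists_abs_le_of_hasCompactSupport {φ : E N → ℝ} (hφ : Continuous φ)
    (hc : HasCompactSupport φ) : ∃ B : ℝ, 0 ≤ B ∧ ∀ x, |φ x| ≤ B := by
  obtain ⟨B, hB⟩ := hφ.bounded_above_of_compact_support hc
  exact ⟨B, (norm_nonneg _).trans (hB 0), hB⟩

theorem integral_comp_mul_fderiv_eq {U : E N → ℝ} (hU : ContDiff ℝ ∞ U) {F : ℝ → ℝ}
    (hF : ContDiff ℝ ∞ F) {φ : E N → ℝ} (hφ : ContDiff ℝ ∞ φ) (hc : HasCompactSupport φ)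
    (w : E N) :
    ∫ x, F (U x) * fderiv ℝ φ x w = - ∫ x, deriv F (U x) * fderiv ℝ U x w * φ x := by
  have hFU : ContDiff ℝ ∞ fun x => F (U x) := hF.comp hU
  have hd : ∀ x, fderiv ℝ (fun x => F (U x)) x w = deriv F (U x) * fderiv ℝ U x w := by
    intro x
    have := (((hF.differentiable (by simp) (U x)).hasDerivAt).comp_hasFDerivAt x
      (hU.differentiable (by simp) x).hasFDerivAt).fderiv
    have e : fderiv ℝ (fun x => F (U x)) x = _ := this
    rw [e]; simp
  rw [integral_mul_fderiv_eq_neg_fderiv_mul_of_integrable]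
  · simp only [hd]
  · exact ((continuous_fderiv_apply hFU w).mul hφ.continuous).integrable_of_hasCompactSupport
      hc.mul_left
  · exact (hFU.continuous.mul (continuous_fderiv_apply hφ w)).integrable_of_hasCompactSupport
      (hasCompactSupport_fderiv_apply hc w).mul_left
  · exact (hFU.continuous.mul hφ.continuous).integrable_of_hasCompactSupport hc.mul_left
  · exact fun x _ => hFU.differentiable (by simp) x
  · exact fun x _ => hφ.differentiable (by simp) x

namespace IsWeakGradient

variable {u : E N → ℝ} {G : E N → E N}

/-- Chain rule for smooth functions with bounded derivative. -/
theorem comp_contDiff (h : IsWeakGradient u G) {s : ℝ} (hs : 1 ≤ s)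
    (hu : MemLp u (ENNReal.ofReal s)) (hG : MemLp G (ENNReal.ofReal s)) {F : ℝ → ℝ}
    (hF : ContDiff ℝ ∞ F) {M : ℝ} (hM : ∀ t, |deriv F t| ≤ M) :
    IsWeakGradient (fun x => F (u x)) (fun x => deriv F (u x) • G x) := by
  have hM0 : 0 ≤ M := (abs_nonneg _).trans (hM 0)
  have hF' : Continuous (deriv F) := hF.continuous_deriv (by simp)
  have hlip : ∀ a b, |F a - F b| ≤ M * |a - b| := fun a b =>
    Convex.norm_image_sub_le_of_norm_deriv_le (fun x _ => hF.differentiable (by simp) x)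
      (fun x _ => hM x) convex_univ (Set.mem_univ b) (Set.mem_univ a)
  have l1 : LocallyIntegrable fun x => F (u x) := by
    refine LocallyIntegrable.mono (f := fun x => |F 0| + M * |u x|) ?_
      (hF.continuous.comp_aestronglyMeasurable hu.1) (Eventually.of_forall fun x => ?_)
    · exact (continuous_const.locallyIntegrable).add
        (fun x => let ⟨t, ht, hi⟩ := h.locallyIntegrable x; ⟨t, ht, hi.abs.const_mul M⟩)
    · have h1 := hlip (u x) 0
      rw [sub_zero] at h1
      have h2 := abs_sub_abs_le_abs_sub (F (u x)) (F 0)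
      rw [Real.norm_eq_abs, Real.norm_eq_abs, abs_of_nonneg (a := |F 0| + _) (by positivity)]
      linarith
  have l2 : LocallyIntegrable fun x => deriv F (u x) • G x := by
    refine LocallyIntegrable.mono (f := fun x => M • G x) (h.locallyIntegrable_grad.smul M)
      ((hF'.comp_aestronglyMeasurable hu.1).smul hG.1) (Eventually.of_forall fun x => ?_)
    rw [norm_smul, norm_smul, Real.norm_eq_abs, Real.norm_eq_abs, abs_of_nonneg hM0]
    gcongr
    exact hM _
  refine ⟨l1, l2, fun φ hφ hc w => ?_⟩
  set U : ℕ → E N → ℝ := fun n => mollify (shrinkingBump N n) u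
  set D : ℕ → E N → E N := fun n => mollify (shrinkingBump N n) G
  have hUc : ∀ n, ContDiff ℝ ∞ (U n) := fun n => contDiff_mollify _ h.locallyIntegrable
  have hDc : ∀ n, Continuous (D n) := fun n => continuous_mollify _ h.locallyIntegrable_grad
  have hfU : ∀ n x w, fderiv ℝ (U n) x w = inner ℝ (D n x) w := fun n x w =>
    h.fderiv_mollify _ x w
  set K := tsupport φ
  have hK : IsCompact K := hc
  have hUK := tendsto_integral_norm_mollify_sub (tendsto_shrinkingBump_rOut N) hs hu hK
  have hDK := tendsto_integral_norm_mollify_sub (tendsto_shrinkingBump_rOut N) hs hG hK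
  have hae := ae_tendsto_mollify_shrinkingBump h.locallyIntegrable
  have iU : ∀ n, IntegrableOn (fun x => U n x - u x) K := fun n =>
    ((hUc n).continuous.locallyIntegrable.integrableOn_isCompact hK).sub
      (h.locallyIntegrable.integrableOn_isCompact hK)
  have iD : ∀ n, IntegrableOn (fun x => D n x - G x) K := fun n =>
    ((hDc n).locallyIntegrable.integrableOn_isCompact hK).sub
      (h.locallyIntegrable_grad.integrableOn_isCompact hK)
  have cd := continuous_fderiv_apply hφ w
  have cds := hasCompactSupport_fderiv_apply hc w
  obtain ⟨B₁, -, hB₁⟩ := exists_abs_le_of_hasCompactSupport cd cds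
  obtain ⟨B₂, -, hB₂⟩ := exists_abs_le_of_hasCompactSupport hφ.continuous hc
  -- `F` is `M`-Lipschitz, so the `L¹(K)` convergence of the mollifications passes to `F ∘ U n`.
  have T1 : Tendsto (fun n => ∫ x, F (U n x) * fderiv ℝ φ x w) atTop
      (𝓝 (∫ x, F (u x) * fderiv ℝ φ x w)) := by
    have hFK : Tendsto (fun n => ∫ x in K, |F (U n x) - F (u x)|) atTop (𝓝 0) := by
      have := hUK.const_mul M
      rw [mul_zero] at this
      refine squeeze_zero (fun n => integral_nonneg fun x => abs_nonneg _) (fun n => ?_) this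
      rw [← integral_const_mul]
      exact integral_mono_of_nonneg (Eventually.of_forall fun x => abs_nonneg _)
        ((iU n).norm.const_mul M) (Eventually.of_forall fun x => hlip _ _)
    have hFi : ∀ n, IntegrableOn (fun x => F (U n x) - F (u x)) K := fun n =>
      ((hF.continuous.comp (hUc n).continuous).locallyIntegrable.integrableOn_isCompact hK).sub
        (l1.integrableOn_isCompact hK)
    have := tendsto_integral_mul_sub_of_bounded (a := fun _ x => fderiv ℝ φ x w)
      (fun _ x => hB₁ x) (fun _ x hx => by
        have := image_eq_zero_of_notMem_tsupport fun hx' => hx (tsupport_fderiv_subset ℝ hx')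
        simp [this]) hFi hFK
    rw [← tendsto_sub_nhds_zero_iff]
    refine this.congr fun n => ?_
    rw [← integral_sub]
    · congr 1 with x; ring
    · exact ((hF.continuous.comp (hUc n).continuous).mul cd).integrable_of_hasCompactSupport
        cds.mul_left
    · exact l1.integrable_smul_right_of_hasCompactSupport cd cds
  have iG : Integrable fun x => inner ℝ (G x) w * φ x := h.integrable_inner_mul hφ.continuous hc w
  have cDn : ∀ n, Continuous fun x => inner ℝ (D n x) w := fun n => (hDc n).inner continuous_const
  have T2 : Tendsto (fun n => ∫ x, deriv F (U n x) * fderiv ℝ (U n) x w * φ x) atTop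
      (𝓝 (∫ x, inner ℝ (deriv F (u x) • G x) w * φ x)) := by
    have hGK : Tendsto (fun n => ∫ x in K, |inner ℝ (D n x) w - inner ℝ (G x) w|) atTop (𝓝 0) := by
      have := hDK.const_mul ‖w‖
      rw [mul_zero] at this
      refine squeeze_zero (fun n => integral_nonneg fun x => abs_nonneg _) (fun n => ?_) this
      rw [← integral_const_mul]
      refine integral_mono_of_nonneg (Eventually.of_forall fun x => abs_nonneg _)
        ((iD n).norm.const_mul ‖w‖) (Eventually.of_forall fun x => ?_)
      dsimp only
      rw [← inner_sub_left, mul_comm]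
      exact abs_real_inner_le_norm _ _
    have hGi : ∀ n, IntegrableOn (fun x => inner ℝ (D n x) w - inner ℝ (G x) w) K := fun n =>
      ((cDn n).locallyIntegrable.integrableOn_isCompact hK).sub
        ((LocallyIntegrable.inner_const h.locallyIntegrable_grad w).integrableOn_isCompact hK)
    -- Write `F'(U n) D n = F'(U n) (D n - G) + F'(U n) G`. The first part vanishes in `L¹` since
    -- `F'` is bounded; the second converges by dominated convergence, as `U n → u` almost
    -- everywhere.
    have A := tendsto_integral_mul_sub_of_bounded (a := fun n x => deriv F (U n x) * φ x)
      (B := M * B₂) (fun n x => by rw [abs_mul]; gcongr; exacts [hM _, hB₂ x])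
      (fun n x hx => by rw [image_eq_zero_of_notMem_tsupport hx, mul_zero]) hGi hGK
    have B : Tendsto (fun n => ∫ x, deriv F (U n x) * (inner ℝ (G x) w * φ x)) atTop
        (𝓝 (∫ x, deriv F (u x) * (inner ℝ (G x) w * φ x))) := by
      refine tendsto_integral_of_dominated_convergence (fun x => M * |inner ℝ (G x) w * φ x|)
        (fun n => (hF'.comp (hUc n).continuous).aestronglyMeasurable.mul iG.1)
        (iG.abs.const_mul M) (fun n => Eventually.of_forall fun x => ?_) ?_
      · rw [norm_mul, Real.norm_eq_abs, Real.norm_eq_abs]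
        gcongr
        exact hM _
      · filter_upwards [hae] with x hx
        exact ((hF'.tendsto _).comp hx).mul_const _
    have AB := A.add B
    rw [zero_add] at AB
    have e : ∫ x, inner ℝ (deriv F (u x) • G x) w * φ x
        = ∫ x, deriv F (u x) * (inner ℝ (G x) w * φ x) := by
      congr 1 with x
      rw [real_inner_smul_left, mul_assoc]
    rw [e]
    refine AB.congr fun n => ?_
    rw [← integral_add]
    · congr 1 with x
      rw [hfU]; ring
    · have i1 : Integrable fun x => deriv F (U n x) * φ x * inner ℝ (D n x) w :=
        (((hF'.comp (hUc n).continuous).mul hφ.continuous).mul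
          (cDn n)).integrable_of_hasCompactSupport hc.mul_left.mul_right
      have i2 : Integrable fun x => inner ℝ (G x) w * (deriv F (U n x) * φ x) :=
        h.integrable_inner_mul ((hF'.comp (hUc n).continuous).mul hφ.continuous) hc.mul_left w
      refine (i1.sub i2).congr (Eventually.of_forall fun x => ?_)
      simp only [Pi.sub_apply]; ring
    · have i2 : Integrable fun x => inner ℝ (G x) w * (deriv F (U n x) * φ x) :=
        h.integrable_inner_mul ((hF'.comp (hUc n).continuous).mul hφ.continuous) hc.mul_left w
      refine i2.congr (Eventually.of_forall fun x => ?_)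
      dsimp only; ring
  refine tendsto_nhds_unique T1 (T2.neg.congr fun n => ?_)
  exact (integral_comp_mul_fderiv_eq (hUc n) hF hφ hc w).symm

end IsWeakGradient

theorem deriv_smoothTransition_of_nonpos {x : ℝ} (hx : x ≤ 0) :
    deriv Real.smoothTransition x = 0 := by
  refine IsLocalMin.deriv_eq_zero (Eventually.of_forall fun y => ?_)
  rw [Real.smoothTransition.zero_of_nonpos hx]
  exact Real.smoothTransition.nonneg y

theorem deriv_smoothTransition_of_one_le {x : ℝ} (hx : 1 ≤ x) :
    deriv Real.smoothTransition x = 0 := by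
  refine IsLocalMax.deriv_eq_zero (Eventually.of_forall fun y => ?_)
  rw [Real.smoothTransition.one_of_one_le hx]
  exact Real.smoothTransition.le_one y

theorem exists_abs_deriv_smoothTransition_le :
    ∃ C : ℝ, 0 < C ∧ ∀ x, |deriv Real.smoothTransition x| ≤ C := by
  obtain ⟨C, hC⟩ := isCompact_Icc.exists_bound_of_continuousOn (s := Set.Icc (0 : ℝ) 1)
    ((Real.smoothTransition.contDiff (n := 1)).continuous_deriv le_rfl).continuousOn
  refine ⟨max C 1, by positivity, fun x => ?_⟩
  by_cases hx : x ∈ Set.Icc (0 : ℝ) 1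
  · exact (hC x hx).trans (le_max_left _ _)
  · have : deriv Real.smoothTransition x = 0 := by
      rcases not_and_or.1 hx with h | h
      · exact deriv_smoothTransition_of_nonpos (not_le.1 h).le
      · exact deriv_smoothTransition_of_one_le (not_le.1 h).le
    rw [this, abs_zero]
    positivity

/-- A smooth approximation of the positive part, at scale `1 / m`. -/
noncomputable def smoothPos (m t : ℝ) : ℝ := t * Real.smoothTransition (m * t)

theorem contDiff_smoothPos (m : ℝ) : ContDiff ℝ ∞ (smoothPos m) :=
  contDiff_id.mul (Real.smoothTransition.contDiff.comp (contDiff_const.mul contDiff_id))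

theorem deriv_smoothPos (m t : ℝ) : deriv (smoothPos m) t
    = Real.smoothTransition (m * t) + m * t * deriv Real.smoothTransition (m * t) := by
  have h1 : HasDerivAt (fun t : ℝ => m * t) m t := by simpa using (hasDerivAt_id t).const_mul m
  have h2 := ((Real.smoothTransition.contDiff (n := 1)).differentiable (by simp)
    (m * t)).hasDerivAt.comp t h1
  have h3 := ((hasDerivAt_id t).mul h2).deriv
  have e : deriv (smoothPos m) t = _ := h3
  rw [e]
  simp only [id_eq, Function.comp_apply]
  ring

theorem abs_smoothPos_le (m t : ℝ) : |smoothPos m t| ≤ |t| := by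
  rw [smoothPos, abs_mul, abs_of_nonneg (Real.smoothTransition.nonneg _)]
  exact mul_le_of_le_one_right (abs_nonneg _) (Real.smoothTransition.le_one _)

/-- The dangerous term `m t S'(m t)` lives only where `0 ≤ m t ≤ 1`, so the bound does not depend on
the scale. -/
theorem exists_abs_deriv_smoothPos_le : ∃ M : ℝ, ∀ m t, |deriv (smoothPos m) t| ≤ M := by
  obtain ⟨C, hC0, hC⟩ := exists_abs_deriv_smoothTransition_le
  refine ⟨1 + C, fun m t => ?_⟩
  rw [deriv_smoothPos]
  refine (abs_add_le _ _).trans (add_le_add ?_ ?_)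
  · rw [abs_of_nonneg (Real.smoothTransition.nonneg _)]
    exact Real.smoothTransition.le_one _
  · rcases le_total (m * t) 0 with h | h
    · rw [deriv_smoothTransition_of_nonpos h, mul_zero, abs_zero]; exact hC0.le
    rcases le_total 1 (m * t) with h' | h'
    · rw [deriv_smoothTransition_of_one_le h', mul_zero, abs_zero]; exact hC0.le
    rw [abs_mul, abs_of_nonneg h]
    exact (mul_le_of_le_one_left (abs_nonneg _) h').trans (hC _)

theorem tendsto_smoothPos (t : ℝ) :
    Tendsto (fun n : ℕ => smoothPos n t) atTop (𝓝 (max t 0)) := by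
  rcases le_or_gt t 0 with h | h
  · refine tendsto_const_nhds.congr fun n => ?_
    rw [smoothPos, Real.smoothTransition.zero_of_nonpos (by nlinarith [n.cast_nonneg (α := ℝ)]),
      mul_zero, max_eq_right h]
  · refine tendsto_const_nhds.congr' ?_
    filter_upwards [tendsto_natCast_atTop_atTop.eventually_ge_atTop (1 / t)] with n hn
    rw [smoothPos, Real.smoothTransition.one_of_one_le ((div_le_iff₀ h).1 hn), mul_one,
      max_eq_left h.le]

/-- The limit at `t = 0` is `0`, so the truncated gradient carries the indicator of the strict
inequality `u > k`. -/
theorem tendsto_deriv_smoothPos (t : ℝ) :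
    Tendsto (fun n : ℕ => deriv (smoothPos n) t) atTop (𝓝 (if 0 < t then 1 else 0)) := by
  rcases le_or_gt t 0 with h | h
  · rw [if_neg (not_lt.2 h)]
    refine tendsto_const_nhds.congr fun n => ?_
    have : (n : ℝ) * t ≤ 0 := by nlinarith [n.cast_nonneg (α := ℝ)]
    rw [deriv_smoothPos, Real.smoothTransition.zero_of_nonpos this,
      deriv_smoothTransition_of_nonpos this, mul_zero, add_zero]
  · rw [if_pos h]
    refine tendsto_const_nhds.congr' ?_
    filter_upwards [tendsto_natCast_atTop_atTop.eventually_ge_atTop (1 / t)] with n hn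
    have := (div_le_iff₀ h).1 hn
    rw [deriv_smoothPos, Real.smoothTransition.one_of_one_le this,
      deriv_smoothTransition_of_one_le this, mul_zero, add_zero]

/-- The weak gradient of a truncation `(u - k)⁺`. -/
theorem IsWeakGradient.posPart_sub {u : E N → ℝ} {G : E N → E N} (h : IsWeakGradient u G) {s : ℝ}
    (hs : 1 ≤ s) (hu : MemLp u (ENNReal.ofReal s)) (hG : MemLp G (ENNReal.ofReal s)) (k : ℝ) :
    IsWeakGradient (fun x => max (u x - k) 0)
      (fun x => (if 0 < u x - k then (1 : ℝ) else 0) • G x) := by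
  obtain ⟨M, hM⟩ := exists_abs_deriv_smoothPos_le
  have hd : ∀ m t, deriv (fun t => smoothPos m (t - k)) t = deriv (smoothPos m) (t - k) :=
    fun m t => deriv_comp_sub_const (f := smoothPos m) k t
  -- Since `M` does not depend on `n`, both sides of this smooth identity converge dominatedly, the
  -- left under `|u - k|` and the right under `M |⟨G, w⟩|`, times test factors.
  have hn : ∀ n : ℕ, IsWeakGradient (fun x => smoothPos n (u x - k))
      (fun x => deriv (smoothPos n) (u x - k) • G x) := fun n => by
    have := h.comp_contDiff hs hu hG (F := fun t => smoothPos n (t - k))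
      ((contDiff_smoothPos n).comp (contDiff_id.sub contDiff_const)) (M := M)
      (fun t => by rw [hd]; exact hM _ _)
    simpa only [hd] using this
  have huk : LocallyIntegrable fun x => u x - k :=
    h.locallyIntegrable.sub continuous_const.locallyIntegrable
  have hmeas : AEStronglyMeasurable (fun x => (if 0 < u x - k then (1 : ℝ) else 0) • G x) := by
    have : Measurable fun t : ℝ => if 0 < t - k then (1 : ℝ) else 0 :=
      Measurable.ite (measurableSet_lt measurable_const (measurable_id.sub_const k))
        measurable_const measurable_const
    have h1 : AEStronglyMeasurable (fun x => if 0 < u x - k then (1 : ℝ) else 0) :=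
      (this.comp_aemeasurable hu.1.aemeasurable).aestronglyMeasurable
    exact h1.smul hG.1
  refine ⟨huk.mono ?_ (Eventually.of_forall fun x => ?_), h.locallyIntegrable_grad.mono hmeas
    (Eventually.of_forall fun x => ?_), fun φ hφ hc w => ?_⟩
  · exact (continuous_id.max continuous_const).comp_aestronglyMeasurable
      (hu.1.sub aestronglyMeasurable_const)
  · rw [Real.norm_eq_abs, abs_of_nonneg (le_max_right _ _), Real.norm_eq_abs]
    exact max_le (le_abs_self _) (abs_nonneg _)
  · rw [norm_smul]
    split_ifs <;> simp
  · have cd := continuous_fderiv_apply hφ w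
    have cds := hasCompactSupport_fderiv_apply hc w
    have i1 : Integrable fun x => (u x - k) * fderiv ℝ φ x w :=
      huk.integrable_smul_right_of_hasCompactSupport cd cds
    have i2 := h.integrable_inner_mul hφ.continuous hc w
    have T1 : Tendsto (fun n : ℕ => ∫ x, smoothPos n (u x - k) * fderiv ℝ φ x w) atTop
        (𝓝 (∫ x, max (u x - k) 0 * fderiv ℝ φ x w)) := by
      refine tendsto_integral_of_dominated_convergence _
        (fun n => ((hn n).integrable_mul cd cds).1) i1.norm
        (fun n => Eventually.of_forall fun x => ?_) (Eventually.of_forall fun x => ?_)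
      · rw [norm_mul, norm_mul]
        gcongr
        exact abs_smoothPos_le _ _
      · exact (tendsto_smoothPos _).mul_const _
    have T2 : Tendsto (fun n : ℕ => ∫ x, inner ℝ (deriv (smoothPos n) (u x - k) • G x) w * φ x)
        atTop (𝓝 (∫ x, inner ℝ ((if 0 < u x - k then (1 : ℝ) else 0) • G x) w * φ x)) := by
      simp only [real_inner_smul_left, mul_assoc]
      refine tendsto_integral_of_dominated_convergence (fun x => M * ‖inner ℝ (G x) w * φ x‖)
        (fun n => ?_) (i2.norm.const_mul M)
        (fun n => Eventually.of_forall fun x => ?_) (Eventually.of_forall fun x => ?_)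
      · have := ((hn n).integrable_inner_mul hφ.continuous hc w).1
        simpa only [real_inner_smul_left, mul_assoc] using this
      · rw [norm_mul]
        gcongr
        exact hM _ _
      · exact (tendsto_deriv_smoothPos _).mul_const _
    exact tendsto_nhds_unique T1 (T2.neg.congr fun n => ((hn n).integral_eq φ hφ hc w).symm)

/-! ### Radial cutoffs -/

/-- A smooth radial function that is `0` where `‖x‖² ≤ a` and `1` where `b ≤ ‖x‖²`. -/
noncomputable def radialCutoff (N : ℕ) (a b : ℝ) (x : E N) : ℝ :=
  Real.smoothTransition ((‖x‖ ^ 2 - a) / (b - a))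

theorem contDiff_radialCutoff (N : ℕ) (a b : ℝ) : ContDiff ℝ ∞ (radialCutoff N a b) :=
  Real.smoothTransition.contDiff.comp (((contDiff_norm_sq ℝ).sub contDiff_const).div_const _)

theorem radialCutoff_nonneg (a b : ℝ) (x : E N) : 0 ≤ radialCutoff N a b x :=
  Real.smoothTransition.nonneg _

theorem radialCutoff_le_one (a b : ℝ) (x : E N) : radialCutoff N a b x ≤ 1 :=
  Real.smoothTransition.le_one _

theorem radialCutoff_eq_zero {a b : ℝ} (hab : a < b) {x : E N} (hx : ‖x‖ ^ 2 ≤ a) :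
    radialCutoff N a b x = 0 :=
  Real.smoothTransition.zero_of_nonpos
    (div_nonpos_of_nonpos_of_nonneg (by linarith) (by linarith))

theorem radialCutoff_eq_one {a b : ℝ} (hab : a < b) {x : E N} (hx : b ≤ ‖x‖ ^ 2) :
    radialCutoff N a b x = 1 :=
  Real.smoothTransition.one_of_one_le (by rw [le_div_iff₀] <;> linarith)

/-- The inner gradient is `2x / (b - a)`, and beyond `‖x‖ = √b` the transition is constant, so `‖x‖`
may be replaced by `√b`. -/
theorem exists_norm_fderiv_radialCutoff_le : ∃ C : ℝ, 0 < C ∧ ∀ (N : ℕ) (a b : ℝ), a < b →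
    ∀ x : E N, ‖fderiv ℝ (radialCutoff N a b) x‖ ≤ C * (2 * √b / (b - a)) := by
  obtain ⟨C, hC0, hC⟩ := exists_abs_deriv_smoothTransition_le
  refine ⟨C, hC0, fun N a b hab x => ?_⟩
  have hba : 0 < b - a := by linarith
  have h1 : HasFDerivAt (fun y : E N => (‖y‖ ^ 2 - a) / (b - a))
      ((b - a)⁻¹ • (2 • innerSL ℝ x)) x := by
    simpa only [div_eq_mul_inv, mul_comm] using
      (((hasStrictFDerivAt_norm_sq x).hasFDerivAt.sub_const a).const_mul (b - a)⁻¹)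
  have h2 := (((Real.smoothTransition.contDiff (n := 1)).differentiable (by simp)
    ((‖x‖ ^ 2 - a) / (b - a))).hasDerivAt.comp_hasFDerivAt x h1).fderiv
  have e : fderiv ℝ (radialCutoff N a b) x = _ := h2
  rw [e, norm_smul, norm_smul]
  by_cases hx : ‖x‖ ≤ √b
  · have h3 : ‖(2 : ℕ) • innerSL ℝ x‖ ≤ 2 * √b := by
      refine (norm_nsmul_le ..).trans ?_
      rw [innerSL_apply_norm]
      push_cast
      linarith
    rw [Real.norm_eq_abs, Real.norm_eq_abs, abs_of_pos (inv_pos.2 hba), div_eq_inv_mul (2 * √b)]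
    exact mul_le_mul (hC _) (mul_le_mul_of_nonneg_left h3 (inv_pos.2 hba).le) (by positivity)
      hC0.le
  · have h3 : b ≤ ‖x‖ ^ 2 := by
      by_contra hlt
      exact hx (Real.le_sqrt_of_sq_le (not_le.1 hlt).le)
    rw [deriv_smoothTransition_of_one_le (by rw [le_div_iff₀ hba]; linarith), norm_zero, zero_mul]
    positivity

/-! ### Sobolev's inequality -/

theorem critExp_pos {q : ℝ} (hq : 1 ≤ q) (hqN : q < N) : 0 < critExp N q := by
  have : (0 : ℝ) < N - q := by linarith
  unfold critExp
  exact div_pos (mul_pos (by linarith) (by linarith)) this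

theorem inv_critExp {q : ℝ} (hq : 1 ≤ q) (hqN : q < N) : (critExp N q)⁻¹ = q⁻¹ - (N : ℝ)⁻¹ := by
  have h1 : (N : ℝ) - q ≠ 0 := by linarith
  have h2 : (N : ℝ) ≠ 0 := by linarith
  have h3 : q ≠ 0 := by linarith
  unfold critExp
  field_simp

theorem lt_critExp {q : ℝ} (hq : 1 ≤ q) (hqN : q < N) : q < critExp N q := by
  have : (0 : ℝ) < (N : ℝ)⁻¹ := by
    rw [inv_pos]; linarith
  rw [← inv_lt_inv₀ (critExp_pos hq hqN) (by linarith), inv_critExp hq hqN]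
  linarith

/-- The Gagliardo–Nirenberg–Sobolev inequality for the `C¹` compactly supported function `U χ`. It
is meant for `U` and `D` the mollifications of `u` and its weak gradient. -/
theorem eLpNorm_critExp_mul_cutoff_le {q : ℝ} (hq : 1 ≤ q) (hqN : q < N) {U : E N → ℝ}
    (hU : ContDiff ℝ ∞ U) {D : E N → E N} (hD : Continuous D)
    (hUD : ∀ x w, fderiv ℝ U x w = inner ℝ (D x) w)
    {χ : E N → ℝ} (hχ : ContDiff ℝ ∞ χ) (hc : HasCompactSupport χ) (hχ1 : ∀ x, |χ x| ≤ 1)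
    {L : ℝ} (hL : 0 ≤ L) (hχL : ∀ x, ‖fderiv ℝ χ x‖ ≤ L) :
    eLpNorm (fun x => U x * χ x) (ENNReal.ofReal (critExp N q)) ≤
      SNormLESNormFDerivOfEqConst ℝ (volume : Measure (E N)) q.toNNReal *
        (eLpNorm D (ENNReal.ofReal q) + ENNReal.ofReal L * eLpNorm U (ENNReal.ofReal q)) := by
  have hfin : Module.finrank ℝ (E N) = N := finrank_euclideanSpace_fin
  have hq1 : 1 ≤ q.toNNReal := by rwa [Real.one_le_toNNReal]
  have hUχ : ContDiff ℝ ∞ fun x => U x * χ x := hU.mul hχ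
  have h1 := eLpNorm_le_eLpNorm_fderiv_of_eq (volume : Measure (E N)) (hUχ.of_le (by simp))
    hc.mul_left (p := q.toNNReal) (p' := (critExp N q).toNNReal) hq1
    (by rw [hfin]; exact_mod_cast (by linarith : (0 : ℝ) < N))
    (by rw [hfin, Real.coe_toNNReal _ (critExp_pos hq hqN).le,
      NNReal.coe_inv, Real.coe_toNNReal q (by linarith), inv_critExp hq hqN])
  refine h1.trans ?_
  gcongr
  have hDU : ∀ x, ‖fderiv ℝ U x‖ ≤ ‖D x‖ := fun x =>
    ContinuousLinearMap.opNorm_le_bound _ (norm_nonneg _) fun w => by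
      rw [hUD]; exact norm_inner_le_norm _ _
  have hle : ∀ x, ‖fderiv ℝ (fun x => U x * χ x) x‖ ≤ ‖(fun x => ‖D x‖ + L * |U x|) x‖ := by
    intro x
    rw [fderiv_fun_mul (hU.differentiable (by simp) x) (hχ.differentiable (by simp) x)]
    rw [Real.norm_eq_abs, abs_of_nonneg (a := ‖D x‖ + L * |U x|) (by positivity)]
    refine (norm_add_le _ _).trans ?_
    rw [norm_smul, norm_smul, Real.norm_eq_abs, Real.norm_eq_abs, add_comm]
    refine add_le_add ?_ ?_
    · exact (mul_le_of_le_one_left (norm_nonneg _) (hχ1 x)).trans (hDU x)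
    · rw [mul_comm]; gcongr; exact hχL x
  refine (eLpNorm_mono hle).trans ?_
  refine (eLpNorm_add_le (f := fun x => ‖D x‖) (g := fun x => L * |U x|)
    hD.norm.aestronglyMeasurable
    (hU.continuous.abs.const_smul L).aestronglyMeasurable (by simpa using hq)).trans ?_
  refine add_le_add (eLpNorm_norm D).le ?_
  have e : (fun x => L * |U x|) = L • fun x => ‖U x‖ := rfl
  rw [e, eLpNorm_const_smul, eLpNorm_norm, Real.enorm_eq_ofReal hL]
  rfl

/-- Sobolev's inequality on `W^{1,q}(ℝᴺ)`, `1 ≤ q < N`. -/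
theorem exists_sobolev_const {q : ℝ} (hq : 1 ≤ q) (hqN : q < N) :
    ∃ C : ℝ, 0 < C ∧ ∀ (u : E N → ℝ) (G : E N → E N), IsWeakGradient u G →
      MemLp u (ENNReal.ofReal q) → MemLp G (ENNReal.ofReal q) →
      eLpNorm u (ENNReal.ofReal (critExp N q)) ≤
        ENNReal.ofReal C * (eLpNorm G (ENNReal.ofReal q) + eLpNorm u (ENNReal.ofReal q)) := by
  obtain ⟨C₀, hC₀, hcut⟩ := exists_norm_fderiv_radialCutoff_le
  set S : ℝ := ((SNormLESNormFDerivOfEqConst ℝ (volume : Measure (E N)) q.toNNReal : NNReal) : ℝ)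
  have hS0 : 0 ≤ S := NNReal.coe_nonneg _
  -- Between radii `n + 1` and `2(n + 1)` the cutoff gradient is at most `C₀ · 4(n+1) / (3(n+1)²) ≤
  -- 4 C₀`; the maximum with `1` lets `L` multiply the gradient term too.
  set L : ℝ := max (C₀ * 4) 1
  have hL1 : 1 ≤ L := le_max_right _ _
  refine ⟨(S + 1) * L, by positivity, fun u G h hu hG => ?_⟩
  set χ : ℕ → E N → ℝ := fun n x =>
    1 - radialCutoff N (((n : ℝ) + 1) ^ 2) (4 * ((n : ℝ) + 1) ^ 2) x with hχdef
  have hab : ∀ n : ℕ, ((n : ℝ) + 1) ^ 2 < 4 * ((n : ℝ) + 1) ^ 2 := fun n => by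
    have : 0 < ((n : ℝ) + 1) ^ 2 := by positivity
    linarith
  have hχ : ∀ n, ContDiff ℝ ∞ (χ n) := fun n => contDiff_const.sub (contDiff_radialCutoff _ _ _)
  have hχ1 : ∀ n x, |χ n x| ≤ 1 := fun n x => by
    rw [abs_le]
    have h1 := radialCutoff_nonneg (((n : ℝ) + 1) ^ 2) (4 * ((n : ℝ) + 1) ^ 2) x
    have h2 := radialCutoff_le_one (((n : ℝ) + 1) ^ 2) (4 * ((n : ℝ) + 1) ^ 2) x
    constructor <;> simp only [hχdef] <;> linarith
  have hχc : ∀ n, HasCompactSupport (χ n) := fun n => by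
    refine HasCompactSupport.intro (isCompact_closedBall (0 : E N) (2 * (n + 1))) fun x hx => ?_
    rw [mem_closedBall_zero_iff, not_le] at hx
    simp only [hχdef]
    rw [radialCutoff_eq_one (hab n), sub_self]
    nlinarith [n.cast_nonneg (α := ℝ)]
  have hχL : ∀ n x, ‖fderiv ℝ (χ n) x‖ ≤ L := fun n x => by
    have h1 : fderiv ℝ (χ n) x = - fderiv ℝ (radialCutoff N (((n : ℝ) + 1) ^ 2)
        (4 * ((n : ℝ) + 1) ^ 2)) x := fderiv_const_sub ..
    rw [h1, norm_neg]
    refine ((hcut N _ _ (hab n) x).trans ?_).trans (le_max_left _ _)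
    gcongr
    have hn : (0 : ℝ) < n + 1 := by positivity
    have h2 : √(4 * ((n : ℝ) + 1) ^ 2) = 2 * (n + 1) := by
      rw [show 4 * ((n : ℝ) + 1) ^ 2 = (2 * (n + 1)) ^ 2 by ring, Real.sqrt_sq (by positivity)]
    rw [h2, div_le_iff₀ (by linarith [hab n])]
    nlinarith [n.cast_nonneg (α := ℝ)]
  have hbound : ∀ n, eLpNorm (fun x => mollify (shrinkingBump N n) u x * χ n x)
      (ENNReal.ofReal (critExp N q)) ≤
        ENNReal.ofReal ((S + 1) * L) *
          (eLpNorm G (ENNReal.ofReal q) + eLpNorm u (ENNReal.ofReal q)) := fun n => by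
    refine (eLpNorm_critExp_mul_cutoff_le hq hqN (contDiff_mollify _ h.locallyIntegrable)
      (continuous_mollify (shrinkingBump N n) h.locallyIntegrable_grad)
      (fun x w => h.fderiv_mollify _ x w) (hχ n) (hχc n) (hχ1 n)
      (by positivity) (hχL n)).trans ?_
    rw [ENNReal.ofReal_mul (by positivity), mul_assoc]
    gcongr
    · rw [← ENNReal.ofReal_coe_nnreal]
      exact ENNReal.ofReal_le_ofReal (by linarith)
    · rw [mul_add]
      gcongr
      · refine (eLpNorm_mollify_le _ hG.1 hq).trans ?_
        exact le_mul_of_one_le_left zero_le (by simpa using hL1)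
      · exact eLpNorm_mollify_le _ hu.1 hq
  -- Fatou: the cut-off mollifications converge to `u` almost everywhere under a uniform bound.
  refine (Lp.eLpNorm_lim_le_liminf_eLpNorm (f := fun n x =>
    mollify (shrinkingBump N n) u x * χ n x) (fun n => ?_) u ?_).trans ?_
  · exact ((continuous_mollify _ h.locallyIntegrable).mul (hχ n).continuous).aestronglyMeasurable
  · filter_upwards [ae_tendsto_mollify_shrinkingBump h.locallyIntegrable] with x hx
    have h1 : Tendsto (fun n => χ n x) atTop (𝓝 1) := by
      refine tendsto_const_nhds.congr' ?_
      filter_upwards [tendsto_natCast_atTop_atTop.eventually_ge_atTop ‖x‖] with n hn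
      simp only [hχdef]
      rw [radialCutoff_eq_zero (hab n), sub_zero]
      have := norm_nonneg x
      gcongr
      linarith
    simpa using hx.mul h1
  · exact (liminf_le_liminf (Eventually.of_forall hbound)).trans (by simp)

/-! ### Growth of the nonlinearity and elementary inequalities -/

/-- A function that is `o(t^{p-1})` at `0` and `o(t^{r-1})` at infinity is dominated by a small
multiple of the first power and a large multiple of the second. -/
theorem exists_growth_bound {p r : ℝ} (hr : 1 < r) {f : ℝ → ℝ} (hf : Continuous f)
    (h0 : Tendsto (fun t : ℝ => |f t| / |t| ^ (p - 1)) (𝓝[≠] 0) (𝓝 0))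
    (hinf : Tendsto (fun t : ℝ => |f t| / |t| ^ (r - 1)) (cocompact ℝ) (𝓝 0)) {c : ℝ} (hc : 0 < c) :
    ∃ C : ℝ, 0 < C ∧ ∀ t : ℝ, 0 < t → |f t| ≤ c * t ^ (p - 1) + C * t ^ (r - 1) := by
  obtain ⟨δ, hδ, h1⟩ := Metric.mem_nhdsWithin_iff.1 (h0.eventually (ge_mem_nhds hc))
  have h2 := (hinf.mono_left atTop_le_cocompact).eventually (ge_mem_nhds one_pos)
  obtain ⟨M, hM⟩ := eventually_atTop.1 h2
  obtain ⟨B, hB⟩ := (isCompact_Icc (a := δ) (b := M)).exists_bound_of_continuousOn hf.continuousOn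
  have hδr : 0 < δ ^ (r - 1) := by positivity
  refine ⟨max 1 (B / δ ^ (r - 1)), by positivity, fun t ht => ?_⟩
  have tp : 0 < t ^ (p - 1) := by positivity
  have tr : 0 < t ^ (r - 1) := by positivity
  -- Three ranges: below `δ` the limit at `0`, above `M` the limit at infinity, and between them the
  -- maximum `B` of `|f|`, with `1 ≤ (t/δ)^(r-1)`.
  rcases lt_or_ge t δ with h | h
  · have h3 : |f t| / |t| ^ (p - 1) ≤ c :=
      h1 ⟨by simpa [abs_of_pos ht] using h, ht.ne'⟩
    rw [abs_of_pos ht, div_le_iff₀ tp] at h3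
    have : 0 ≤ max 1 (B / δ ^ (r - 1)) * t ^ (r - 1) := by positivity
    linarith
  · have h4 : |f t| ≤ max 1 (B / δ ^ (r - 1)) * t ^ (r - 1) := by
      rcases le_total t M with h' | h'
      · calc |f t| ≤ B := hB t ⟨h, h'⟩
          _ = B / δ ^ (r - 1) * δ ^ (r - 1) := by field_simp
          _ ≤ max 1 (B / δ ^ (r - 1)) * t ^ (r - 1) := by
            have hB0 : 0 ≤ B := (norm_nonneg _).trans (hB t ⟨h, h'⟩)
            gcongr
            exact le_max_right _ _
      · have h3 := hM t h'
        rw [abs_of_pos ht, div_le_iff₀ tr] at h3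
        exact h3.trans (by gcongr; exact le_max_left _ _)
    have : 0 < c * t ^ (p - 1) := by positivity
    linarith

/-- Young's inequality by cases: if `2b ≤ a` the product is at most `a^s / 2`, otherwise `a^(s-1) ≤
(2b)^(s-1)`. It absorbs the term with the cutoff gradient. -/
theorem half_rpow_sub_le {s a b : ℝ} (hs : 1 < s) (ha : 0 ≤ a) (hb : 0 ≤ b) :
    a ^ s / 2 - 2 ^ (s - 1) * b ^ s ≤ a ^ s - a ^ (s - 1) * b := by
  have has : a ^ s = a ^ (s - 1) * a := by
    rw [← Real.rpow_add_one' ha (by linarith)]; ring_nf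
  have hbs : b ^ s = b ^ (s - 1) * b := by
    rw [← Real.rpow_add_one' hb (by linarith)]; ring_nf
  have h1 : 0 ≤ a ^ (s - 1) := by positivity
  have h2 : 0 ≤ b ^ (s - 1) := by positivity
  rcases le_total (2 * b) a with h | h
  · have : 0 ≤ (2 : ℝ) ^ (s - 1) * b ^ s := by positivity
    rw [has]
    nlinarith
  · have h3 : a ^ (s - 1) ≤ 2 ^ (s - 1) * b ^ (s - 1) := by
      rw [← Real.mul_rpow (by norm_num) hb]
      exact Real.rpow_le_rpow ha h (by linarith)
    have h4 : 0 ≤ a ^ s := by positivity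
    have h5 : a ^ (s - 1) * b ≤ 2 ^ (s - 1) * b ^ s := by
      rw [hbs, ← mul_assoc]
      gcongr
    linarith

theorem norm_rpow_mul_inner_self {F : Type*} [NormedAddCommGroup F] [InnerProductSpace ℝ F]
    {s : ℝ} (hs : 1 < s) (g : F) : ‖g‖ ^ (s - 2) * inner ℝ g g = ‖g‖ ^ s := by
  rcases (norm_nonneg g).eq_or_lt with h | h
  · rw [real_inner_self_eq_norm_sq, ← h, Real.zero_rpow (by linarith : s ≠ 0)]; simp
  · rw [real_inner_self_eq_norm_sq, ← Real.rpow_natCast, ← Real.rpow_add h]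
    norm_num

theorem norm_rpow_mul_abs_inner_le {F : Type*} [NormedAddCommGroup F] [InnerProductSpace ℝ F]
    (s : ℝ) (g z : F) : ‖g‖ ^ (s - 2) * |inner ℝ g z| ≤ ‖g‖ ^ (s - 1) * ‖z‖ := by
  rcases (norm_nonneg g).eq_or_lt with h | h
  · have : g = 0 := norm_eq_zero.1 h.symm
    subst this
    simp only [inner_zero_left, abs_zero, mul_zero]
    positivity
  · calc ‖g‖ ^ (s - 2) * |inner ℝ g z| ≤ ‖g‖ ^ (s - 2) * (‖g‖ * ‖z‖) := by
          gcongr; exact abs_real_inner_le_norm _ _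
      _ = ‖g‖ ^ (s - 1) * ‖z‖ := by
          rw [← mul_assoc, ← Real.rpow_add_one h.ne']; ring_nf

/-- Lower bound for the `s`-Laplacian term tested with a truncation times a cutoff `ζ`, whose
gradient is `z`. -/
theorem le_rpow_mul_inner_cutoff {F : Type*} [NormedAddCommGroup F] [InnerProductSpace ℝ F]
    {s K ζ w : ℝ} (hs : 1 < s) (hK : 0 ≤ K) (hζ : 0 ≤ ζ) (hw : 0 ≤ w) (g z : F)
    (hz : ‖z‖ ≤ K * ζ ^ (1 - 1 / s)) :
    ‖g‖ ^ s * ζ / 2 - 2 ^ (s - 1) * (K * w) ^ s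
      ≤ ‖g‖ ^ (s - 2) * inner ℝ g (ζ • g + w • z) := by
  have s0 : s ≠ 0 := by linarith
  -- The power `1 - 1/s` in the cutoff bound is exactly what turns `‖g‖^(s-1) ‖z‖` into `(‖g‖
  -- ζ^(1/s))^(s-1) K`, so half of `‖g‖^s ζ` suffices for absorption.
  have h1 := half_rpow_sub_le (a := ‖g‖ * ζ ^ (1 / s)) (b := K * w) hs (by positivity)
    (by positivity)
  have e1 : (‖g‖ * ζ ^ (1 / s)) ^ s = ‖g‖ ^ s * ζ := by
    rw [Real.mul_rpow (norm_nonneg _) (by positivity), ← Real.rpow_mul hζ, one_div_mul_cancel s0,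
      Real.rpow_one]
  have e2 : (‖g‖ * ζ ^ (1 / s)) ^ (s - 1) = ‖g‖ ^ (s - 1) * ζ ^ (1 - 1 / s) := by
    rw [Real.mul_rpow (norm_nonneg _) (by positivity), ← Real.rpow_mul hζ]
    congr 2
    field_simp
  rw [e1, e2] at h1
  refine h1.trans ?_
  rw [inner_add_right, real_inner_smul_right, real_inner_smul_right]
  have h2 := norm_rpow_mul_inner_self hs g
  have h3 := norm_rpow_mul_abs_inner_le s g z
  have h4 : -(‖g‖ ^ (s - 2) * |inner ℝ g z|) ≤ ‖g‖ ^ (s - 2) * inner ℝ g z := by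
    rw [← mul_neg]
    exact mul_le_mul_of_nonneg_left (neg_abs_le _) (by positivity)
  have h5 : ‖g‖ ^ (s - 1) * ‖z‖ ≤ ‖g‖ ^ (s - 1) * (K * ζ ^ (1 - 1 / s)) := by gcongr
  have h6 : w * (-(‖g‖ ^ (s - 1) * (K * ζ ^ (1 - 1 / s)))) ≤ w * (‖g‖ ^ (s - 2) * inner ℝ g z) :=
    mul_le_mul_of_nonneg_left (by linarith) hw
  have e3 : ‖g‖ ^ (s - 2) * (ζ * inner ℝ g g + w * inner ℝ g z)
      = ζ * (‖g‖ ^ (s - 2) * inner ℝ g g) + w * (‖g‖ ^ (s - 2) * inner ℝ g z) := by ring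
  rw [e3, h2]
  linarith

theorem rpow_le_add_rpow {t a b c : ℝ} (ht : 0 ≤ t) (ha : 0 < a) (hab : a ≤ b) (hbc : b ≤ c) :
    t ^ b ≤ t ^ a + t ^ c := by
  rcases le_total t 1 with h | h
  · have h1 : t ^ b ≤ t ^ a := Real.rpow_le_rpow_of_exponent_ge_of_imp ht h hab (fun _ => by
      intro h'; linarith)
    have : 0 ≤ t ^ c := by positivity
    linarith
  · have h1 : t ^ b ≤ t ^ c := Real.rpow_le_rpow_of_exponent_le h hbc
    have : 0 ≤ t ^ a := by positivity
    linarith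

theorem add_rpow_le_two_mul {s a b : ℝ} (hs : 0 ≤ s) (ha : 0 ≤ a) (hb : 0 ≤ b) :
    (a + b) ^ s ≤ 2 ^ s * (a ^ s + b ^ s) := by
  have h1 : a + b ≤ 2 * max a b := by linarith [le_max_left a b, le_max_right a b]
  calc (a + b) ^ s ≤ (2 * max a b) ^ s := Real.rpow_le_rpow (by positivity) h1 hs
    _ = 2 ^ s * max a b ^ s := Real.mul_rpow (by norm_num) (by positivity)
    _ ≤ 2 ^ s * (a ^ s + b ^ s) := by
      gcongr
      rcases max_choice a b with h | h <;> rw [h]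
      · linarith [Real.rpow_nonneg hb s]
      · linarith [Real.rpow_nonneg ha s]

/-- On `{h ≤ W}`, powers below `r` are dominated by the `r`-th power. -/
theorem mul_rpow_le_of_le {s r K Λ h W w : ℝ} (hs : 0 ≤ s) (hsr : s ≤ r) (hK : 0 ≤ K) (hKΛ : K ≤ Λ)
    (hh : 0 < h) (hΛh : 1 ≤ Λ * h) (hw : 0 ≤ w) (hwW : w ≤ W) (hhW : h ≤ W) :
    (K * w) ^ s ≤ Λ ^ r * W ^ r := by
  have hΛ : 0 ≤ Λ := hK.trans hKΛ
  have hW : 0 ≤ W := hh.le.trans hhW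
  have h1 : 1 ≤ Λ * W := hΛh.trans (by gcongr)
  calc (K * w) ^ s ≤ (Λ * W) ^ s := by gcongr
    _ ≤ (Λ * W) ^ r := Real.rpow_le_rpow_of_exponent_le h1 hsr
    _ = Λ ^ r * W ^ r := Real.mul_rpow hΛ hW

/-! ### Norms and Sobolev's inequality as integrals -/

theorem memLp_iff_integrable_norm_rpow {F : Type*} [NormedAddCommGroup F] {s : ℝ} (hs : 0 < s)
    {g : E N → F} (hg : AEStronglyMeasurable g) :
    MemLp g (ENNReal.ofReal s) ↔ Integrable fun x => ‖g x‖ ^ s := by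
  have := integrable_norm_rpow_iff hg (p := ENNReal.ofReal s) (by simpa using hs)
    ENNReal.ofReal_ne_top
  rw [ENNReal.toReal_ofReal hs.le] at this
  exact this.symm

theorem eLpNorm_ofReal_eq {F : Type*} [NormedAddCommGroup F] {s : ℝ} (hs : 0 < s)
    {g : E N → F} (hg : MemLp g (ENNReal.ofReal s)) :
    eLpNorm g (ENNReal.ofReal s) volume = ENNReal.ofReal ((∫ x, ‖g x‖ ^ s) ^ s⁻¹) := by
  rw [hg.eLpNorm_eq_integral_rpow_norm (by simpa using hs) ENNReal.ofReal_ne_top,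
    ENNReal.toReal_ofReal hs.le]

theorem MemW1.w1Norm_rpow {s : ℝ} (hs : 0 < s) {u : E N → ℝ} (hu : MemW1 s u) :
    w1Norm s u ^ s = ENNReal.ofReal ((∫ x, ‖weakGrad u x‖ ^ s) + ∫ x, |u x| ^ s) := by
  have e : ∀ a : ℝ, 0 ≤ a → ENNReal.ofReal (a ^ s⁻¹) ^ s = ENNReal.ofReal a := fun a ha => by
    rw [ENNReal.ofReal_rpow_of_nonneg (by positivity) hs.le, ← Real.rpow_mul ha,
      inv_mul_cancel₀ hs.ne', Real.rpow_one]
  have i1 : 0 ≤ ∫ x, ‖weakGrad u x‖ ^ s := integral_nonneg fun x => by positivity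
  have i2 : 0 ≤ ∫ x, ‖u x‖ ^ s := integral_nonneg fun x => by positivity
  rw [w1Norm, ← ENNReal.rpow_mul, one_div_mul_cancel hs.ne', ENNReal.rpow_one,
    eLpNorm_ofReal_eq hs hu.memLp, eLpNorm_ofReal_eq hs hu.memLp_grad, e _ i1, e _ i2,
    ← ENNReal.ofReal_add i1 i2]
  rfl

/-- Sobolev's inequality for integrals. -/
theorem exists_sobolev_integral_const {q : ℝ} (hq : 1 ≤ q) (hqN : q < N) :
    ∃ C : ℝ, 0 < C ∧ ∀ u : E N → ℝ, MemW1 q u →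
      MemLp u (ENNReal.ofReal (critExp N q)) ∧
      ∫ x, |u x| ^ critExp N q ≤
        C * ((∫ x, ‖weakGrad u x‖ ^ q) + ∫ x, |u x| ^ q) ^ (critExp N q / q) := by
  obtain ⟨C, hC, h⟩ := exists_sobolev_const hq hqN
  have q0 : 0 < q := by linarith
  have c0 := critExp_pos hq hqN
  refine ⟨(2 * C) ^ critExp N q, by positivity, fun u hu => ?_⟩
  have h1 := h u _ hu.isWeakGradient hu.memLp hu.memLp_grad
  have hmem : MemLp u (ENNReal.ofReal (critExp N q)) :=
    ⟨hu.memLp.1, h1.trans_lt (ENNReal.mul_lt_top ENNReal.ofReal_lt_top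
      (ENNReal.add_lt_top.2 ⟨hu.memLp_grad.2, hu.memLp.2⟩))⟩
  refine ⟨hmem, ?_⟩
  have i1 : 0 ≤ ∫ x, ‖weakGrad u x‖ ^ q := integral_nonneg fun x => by positivity
  have i2 : 0 ≤ ∫ x, ‖u x‖ ^ q := integral_nonneg fun x => by positivity
  have i3 : 0 ≤ ∫ x, ‖u x‖ ^ critExp N q := integral_nonneg fun x => by positivity
  rw [eLpNorm_ofReal_eq c0 hmem, eLpNorm_ofReal_eq q0 hu.memLp, eLpNorm_ofReal_eq q0 hu.memLp_grad,
    ← ENNReal.ofReal_add (by positivity) (by positivity), ← ENNReal.ofReal_mul hC.le,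
    ENNReal.ofReal_le_ofReal_iff (by positivity)] at h1
  simp only [← Real.norm_eq_abs]
  set a := ∫ x, ‖weakGrad u x‖ ^ q
  set b := ∫ x, ‖u x‖ ^ q
  set c := ∫ x, ‖u x‖ ^ critExp N q
  -- Both `a^(1/q)` and `b^(1/q)` are at most `(a + b)^(1/q)`, which is where `2C` comes from.
  have h2 : c ^ (critExp N q)⁻¹ ≤ 2 * C * (a + b) ^ q⁻¹ := by
    have ha : a ^ q⁻¹ ≤ (a + b) ^ q⁻¹ := by gcongr; linarith
    have hb : b ^ q⁻¹ ≤ (a + b) ^ q⁻¹ := by gcongr; linarith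
    nlinarith
  have hab : 0 ≤ a + b := by positivity
  calc c = (c ^ (critExp N q)⁻¹) ^ critExp N q := by
        rw [← Real.rpow_mul i3, inv_mul_cancel₀ c0.ne', Real.rpow_one]
    _ ≤ (2 * C * (a + b) ^ q⁻¹) ^ critExp N q := Real.rpow_le_rpow (by positivity) h2 c0.le
    _ = _ := by
        rw [Real.mul_rpow (by positivity) (by positivity), ← Real.rpow_mul hab, inv_mul_eq_div]

theorem MemW1.integrable_abs_rpow {q r : ℝ} (hq : 1 ≤ q) (hqN : q < N) (hqr : q ≤ r)
    (hr : r ≤ critExp N q) {u : E N → ℝ} (hu : MemW1 q u) : Integrable fun x => |u x| ^ r := by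
  obtain ⟨C, -, h⟩ := exists_sobolev_integral_const hq hqN
  have h1 := (memLp_iff_integrable_norm_rpow (by linarith) hu.memLp.1).1 hu.memLp
  have h2 := (memLp_iff_integrable_norm_rpow (critExp_pos hq hqN) hu.memLp.1).1 (h u hu).1
  refine (h1.add h2).mono' (hu.memLp.1.aemeasurable.norm.pow_const r).aestronglyMeasurable
    (Eventually.of_forall fun x => ?_)
  rw [Real.norm_of_nonneg (by positivity)]
  exact rpow_le_add_rpow (abs_nonneg _) (by linarith) hqr hr

/-! ### Cutoffs and truncated test functions -/

/-- Smooth cutoff functions `ζ` with `|∇ζ| ≤ K ζ^{1-1/q}`. -/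
structure IsCutoff (q K : ℝ) (ζ : E N → ℝ) : Prop where
  contDiff : ContDiff ℝ ∞ ζ
  nonneg : ∀ x, 0 ≤ ζ x
  le_one : ∀ x, ζ x ≤ 1
  norm_gradient_le : ∀ x, ‖gradient ζ x‖ ≤ K * ζ x ^ (1 - 1 / q)

/-- The test function `(u - k)⁺ ζ`. -/
def truncTest (u : E N → ℝ) (k : ℝ) (ζ : E N → ℝ) (x : E N) : ℝ := max (u x - k) 0 * ζ x

/-- The weak gradient of `truncTest u k ζ` when `G` is that of `u`. -/
noncomputable def truncGrad (u : E N → ℝ) (G : E N → E N) (k : ℝ) (ζ : E N → ℝ) (x : E N) : E N :=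
  ζ x • ((if 0 < u x - k then (1 : ℝ) else 0) • G x) + max (u x - k) 0 • gradient ζ x

theorem max_sub_le_abs {t k : ℝ} (hk : 0 ≤ k) : max (t - k) 0 ≤ |t| :=
  max_le (by linarith [le_abs_self t]) (abs_nonneg _)

/-! ### Pointwise inequalities behind the Caccioppoli estimate -/

section Scalar

variable {F : Type*} [NormedAddCommGroup F] [InnerProductSpace ℝ F]

/-- Pointwise lower bound for the integrand of the weak equation tested with `(u - k - h)⁺ ζ`. -/
theorem le_weak_integrand {p q r V V₀ C K Λ k h t ζ : ℝ} {f : ℝ → ℝ} (hp : 1 < p) (hpq : p < q)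
    (hqr : q < r) (hV : V₀ ≤ V) (hV₀ : 0 < V₀) (hC : 0 < C)
    (hf : ∀ t : ℝ, 0 < t → |f t| ≤ V₀ * t ^ (p - 1) + C * t ^ (r - 1))
    (hK : 0 ≤ K) (hKΛ : K ≤ Λ) (hk : 0 ≤ k) (hh : 0 < h) (hΛh : 1 ≤ Λ * h) (hkh : k + h ≤ Λ * h)
    (ht : 0 < t) (hζ0 : 0 ≤ ζ) (hζ1 : ζ ≤ 1) (g z : F) (hz : ‖z‖ ≤ K * ζ ^ (1 - 1 / q)) :
    (if 0 < t - (k + h) then ‖g‖ ^ q else 0) * ζ / 2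
      - (2 ^ (p - 1) + 2 ^ (q - 1) + C) * (if 0 < ζ then Λ ^ r * max (t - k) 0 ^ r else 0)
    ≤ ‖g‖ ^ (p - 2) * inner ℝ g (ζ • ((if 0 < t - (k + h) then (1 : ℝ) else 0) • g)
          + max (t - (k + h)) 0 • z)
      + ‖g‖ ^ (q - 2) * inner ℝ g (ζ • ((if 0 < t - (k + h) then (1 : ℝ) else 0) • g)
          + max (t - (k + h)) 0 • z)
      + V * (|t| ^ (p - 2) * t + |t| ^ (q - 2) * t) * (max (t - (k + h)) 0 * ζ)
      - f t * (max (t - (k + h)) 0 * ζ) := by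
  have hΛ : 0 ≤ Λ := hK.trans hKΛ
  by_cases h1 : 0 < t - (k + h)
  swap
  · rw [if_neg h1, if_neg h1, max_eq_right (not_lt.1 h1)]
    have : 0 ≤ if 0 < ζ then Λ ^ r * max (t - k) 0 ^ r else 0 := by
      split_ifs <;> positivity
    have h2 : 0 ≤ (2 ^ (p - 1) + 2 ^ (q - 1) + C) * (if 0 < ζ then Λ ^ r * max (t - k) 0 ^ r else 0)
      := by positivity
    simp only [zero_smul, smul_zero, add_zero, inner_zero_right, mul_zero, zero_mul, zero_div,
      sub_zero]
    linarith
  rw [if_pos h1, if_pos h1, one_smul, max_eq_left h1.le]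
  -- Where `ζ = 0` the bound forces `z = 0`, because `1 - 1/q > 0`.
  rcases hζ0.eq_or_lt with h0 | h0
  · subst h0
    have e : (1 : ℝ) - 1 / q ≠ 0 := by
      have : 1 / q < 1 := by rw [div_lt_one] <;> linarith
      linarith
    rw [Real.zero_rpow e, mul_zero] at hz
    rw [norm_le_zero_iff.1 hz]
    simp
  rw [if_pos h0, max_eq_left (by linarith)]
  set w := t - (k + h) with hw
  set W := t - k with hW
  have hwW : w ≤ W := by linarith
  have hhW : h ≤ W := by linarith
  have bp := mul_rpow_le_of_le (by linarith) (hpq.trans hqr).le hK hKΛ hh hΛh h1.le hwW hhW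
  have bq := mul_rpow_le_of_le (by linarith) hqr.le hK hKΛ hh hΛh h1.le hwW hhW
  -- As `ζ ≤ 1` and `p < q`, a cutoff suited to `q` is also suited to `p`.
  have hzp : ‖z‖ ≤ K * ζ ^ (1 - 1 / p) := by
    refine hz.trans ?_
    gcongr 1
    refine Real.rpow_le_rpow_of_exponent_ge h0 hζ1 ?_
    have : 1 / q ≤ 1 / p := one_div_le_one_div_of_le (by linarith) hpq.le
    linarith
  have a1 := le_rpow_mul_inner_cutoff hp hK hζ0 h1.le g z hzp
  have a2 := le_rpow_mul_inner_cutoff (hp.trans hpq) hK hζ0 h1.le g z hz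
  have a3 : 0 ≤ ‖g‖ ^ p * ζ := by positivity
  -- `t = (k + h) + (W - h) ≤ Λ h + Λ (W - h)`.
  have tΛ : t ≤ Λ * W := by
    have : 1 ≤ Λ := by nlinarith
    nlinarith
  have hw0 : 0 ≤ w * ζ := by positivity
  have hwζ : w * ζ ≤ Λ * W := by
    have : w * ζ ≤ w := mul_le_of_le_one_right h1.le hζ1
    linarith
  have ΛW : 0 < Λ * W := by linarith
  have b3 : t ^ (r - 1) * (w * ζ) ≤ Λ ^ r * W ^ r := by
    calc t ^ (r - 1) * (w * ζ) ≤ (Λ * W) ^ (r - 1) * (Λ * W) := by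
          have : t ^ (r - 1) ≤ (Λ * W) ^ (r - 1) := Real.rpow_le_rpow ht.le tΛ (by linarith)
          gcongr
      _ = (Λ * W) ^ r := by rw [← Real.rpow_add_one ΛW.ne']; ring_nf
      _ = Λ ^ r * W ^ r := Real.mul_rpow hΛ (by linarith)
  have tp : |t| ^ (p - 2) * t = t ^ (p - 1) := by
    rw [abs_of_pos ht, ← Real.rpow_add_one ht.ne']; ring_nf
  have tq : 0 ≤ |t| ^ (q - 2) * t := by positivity
  -- The growth bound was taken with coefficient `V₀` precisely so that the potential absorbs the
  -- `t^(p-1)` part of `f`.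
  have b4 : V₀ * t ^ (p - 1) ≤ V * (|t| ^ (p - 2) * t + |t| ^ (q - 2) * t) := by
    rw [tp]
    have : 0 ≤ t ^ (p - 1) := by positivity
    have hV' : 0 ≤ V := by linarith
    gcongr
    linarith
  have b5 : -(C * t ^ (r - 1)) ≤ V * (|t| ^ (p - 2) * t + |t| ^ (q - 2) * t) - f t := by
    have := hf t ht
    linarith [le_abs_self (f t)]
  have b6 := mul_le_mul_of_nonneg_right b5 hw0
  have b7 : C * (t ^ (r - 1) * (w * ζ)) ≤ C * (Λ ^ r * W ^ r) := by gcongr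
  have b8 : (2 : ℝ) ^ (p - 1) * (K * w) ^ p ≤ 2 ^ (p - 1) * (Λ ^ r * W ^ r) := by gcongr
  have b9 : (2 : ℝ) ^ (q - 1) * (K * w) ^ q ≤ 2 ^ (q - 1) * (Λ ^ r * W ^ r) := by gcongr
  linarith

/-- Passes from the weighted gradient `‖g‖^q ζ`, which the equation controls, to the full gradient
of the test function, which Sobolev's inequality needs; `ζ^q ≤ ζ` makes this possible. -/
theorem norm_cutoff_grad_rpow_le {q r K Λ k h t ζ : ℝ} (hq : 1 < q)
    (hqr : q < r) (hK : 0 ≤ K) (hKΛ : K ≤ Λ) (hh : 0 < h) (hΛh : 1 ≤ Λ * h)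
    (hζ0 : 0 ≤ ζ) (hζ1 : ζ ≤ 1) (g z : F) (hz : ‖z‖ ≤ K * ζ ^ (1 - 1 / q)) :
    ‖ζ • ((if 0 < t - (k + h) then (1 : ℝ) else 0) • g) + max (t - (k + h)) 0 • z‖ ^ q
      ≤ 2 ^ q * ((if 0 < t - (k + h) then ‖g‖ ^ q else 0) * ζ
        + (if 0 < ζ then Λ ^ r * max (t - k) 0 ^ r else 0)) := by
  have q0 : q ≠ 0 := by linarith
  have hΛ : 0 ≤ Λ := hK.trans hKΛ
  by_cases h1 : 0 < t - (k + h)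
  swap
  · rw [if_neg h1, if_neg h1, max_eq_right (not_lt.1 h1)]
    have : 0 ≤ if 0 < ζ then Λ ^ r * max (t - k) 0 ^ r else 0 := by
      split_ifs <;> positivity
    simp only [zero_smul, smul_zero, add_zero, norm_zero, Real.zero_rpow q0]
    positivity
  rw [if_pos h1, if_pos h1, one_smul, max_eq_left h1.le]
  rcases hζ0.eq_or_lt with h0 | h0
  · subst h0
    have e : (1 : ℝ) - 1 / q ≠ 0 := by
      have : 1 / q < 1 := by rw [div_lt_one] <;> linarith
      linarith
    rw [Real.zero_rpow e, mul_zero] at hz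
    rw [norm_le_zero_iff.1 hz]
    simp [Real.zero_rpow q0]
  rw [if_pos h0, max_eq_left (by linarith)]
  have bq := mul_rpow_le_of_le (w := t - (k + h)) (W := t - k) (by linarith) hqr.le hK hKΛ hh hΛh
    h1.le (by linarith) (by linarith)
  have hζq : ζ ^ q ≤ ζ := by
    simpa using Real.rpow_le_rpow_of_exponent_ge h0 hζ1 hq.le
  have hz1 : ‖z‖ ≤ K := hz.trans (mul_le_of_le_one_right hK (Real.rpow_le_one hζ0 hζ1 (by
    have : 1 / q < 1 := by rw [div_lt_one] <;> linarith
    linarith)))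
  calc ‖ζ • g + (t - (k + h)) • z‖ ^ q ≤ (ζ * ‖g‖ + K * (t - (k + h))) ^ q := by
        gcongr
        refine (norm_add_le _ _).trans ?_
        rw [norm_smul, norm_smul, Real.norm_of_nonneg hζ0, Real.norm_of_nonneg h1.le, mul_comm K]
        gcongr
    _ ≤ 2 ^ q * ((ζ * ‖g‖) ^ q + (K * (t - (k + h))) ^ q) :=
        add_rpow_le_two_mul (by linarith) (by positivity) (by positivity)
    _ ≤ _ := by
        rw [Real.mul_rpow hζ0 (norm_nonneg _), mul_comm (‖g‖ ^ q)]
        gcongr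

theorem cutoff_rpow_le {q r Λ k h t ζ : ℝ} (hq : 1 < q)
    (hqr : q < r) (hΛ : 1 ≤ Λ) (hh : 0 < h) (hΛh : 1 ≤ Λ * h)
    (hζ0 : 0 ≤ ζ) (hζ1 : ζ ≤ 1) :
    |max (t - (k + h)) 0 * ζ| ^ q ≤ if 0 < ζ then Λ ^ r * max (t - k) 0 ^ r else 0 := by
  have q0 : q ≠ 0 := by linarith
  by_cases h1 : 0 < t - (k + h)
  swap
  · rw [max_eq_right (not_lt.1 h1), zero_mul, abs_zero, Real.zero_rpow q0]
    split_ifs <;> positivity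
  rcases hζ0.eq_or_lt with h0 | h0
  · simp [← h0, Real.zero_rpow q0]
  rw [max_eq_left h1.le, max_eq_left (by linarith), if_pos h0, abs_of_nonneg (by positivity)]
  have bq := mul_rpow_le_of_le (w := t - (k + h)) (W := t - k) (by linarith) hqr.le zero_le_one hΛ
    hh hΛh h1.le (by linarith) (by linarith)
  refine le_trans ?_ bq
  rw [one_mul]
  gcongr
  exact mul_le_of_le_one_right h1.le hζ1

end Scalar

/-! ### Admissibility of test functions and integrability -/

namespace IsCutoff

variable {q K : ℝ} {ζ : E N → ℝ}

theorem norm_gradient_le_const (hζ : IsCutoff q K ζ) (hq : 1 < q) (hK : 0 ≤ K) (x : E N) :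
    ‖gradient ζ x‖ ≤ K :=
  (hζ.norm_gradient_le x).trans (mul_le_of_le_one_right hK
    (Real.rpow_le_one (hζ.nonneg x) (hζ.le_one x) (by
      have : 1 / q < 1 := by rw [div_lt_one] <;> linarith
      linarith)))

theorem isWeakGradient_truncTest (hζ : IsCutoff q K ζ) {s : ℝ} (hs : 1 ≤ s) {u : E N → ℝ}
    (hu : MemW1 s u) (k : ℝ) :
    IsWeakGradient (truncTest u k ζ) (truncGrad u (weakGrad u) k ζ) :=
  (hu.isWeakGradient.posPart_sub hs hu.memLp hu.memLp_grad k).mul_contDiff hζ.contDiff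

theorem abs_truncTest_le (hζ : IsCutoff q K ζ) {u : E N → ℝ} {k : ℝ} (hk : 0 ≤ k) (x : E N) :
    |truncTest u k ζ x| ≤ |u x| := by
  rw [truncTest, abs_mul, abs_of_nonneg (hζ.nonneg x), abs_of_nonneg (le_max_right _ _)]
  exact (mul_le_of_le_one_right (le_max_right _ _) (hζ.le_one x)).trans (max_sub_le_abs hk)

theorem memW1_truncTest (hζ : IsCutoff q K ζ) (hq : 1 < q) (hK : 0 ≤ K) {s : ℝ} (hs : 1 ≤ s)
    {u : E N → ℝ} (hu : MemW1 s u) {k : ℝ} (hk : 0 ≤ k) : MemW1 s (truncTest u k ζ) := by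
  have h := hζ.isWeakGradient_truncTest hs hu k
  refine .of_isWeakGradient h ?_ ?_
  · exact hu.memLp.mono h.locallyIntegrable.aestronglyMeasurable
      (Eventually.of_forall fun x => hζ.abs_truncTest_le hk x)
  · refine (hu.memLp_grad.norm.add (hu.memLp.norm.const_mul K)).mono
      h.locallyIntegrable_grad.aestronglyMeasurable (Eventually.of_forall fun x => ?_)
    rw [Pi.add_apply, Real.norm_of_nonneg (by positivity)]
    refine (norm_add_le _ _).trans (add_le_add ?_ ?_)
    · rw [norm_smul, norm_smul, Real.norm_of_nonneg (hζ.nonneg x)]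
      refine (mul_le_of_le_one_left (by positivity) (hζ.le_one x)).trans ?_
      refine mul_le_of_le_one_left (norm_nonneg _) ?_
      split_ifs <;> simp
    · rw [norm_smul, Real.norm_of_nonneg (le_max_right _ _), mul_comm]
      exact mul_le_mul (hζ.norm_gradient_le_const hq hK x) (max_sub_le_abs hk) (le_max_right _ _) hK

/-- Since `k ≥ 0`, the test function is dominated by `|u|`, so its potential energy is finite even
for unbounded `V`. -/
theorem memEnergySpace_truncTest (hζ : IsCutoff q K ζ) {p : ℝ} (hp : 1 < p) (hpq : p < q)
    (hK : 0 ≤ K) {V : E N → ℝ} (hVm : Measurable V) (hV : ∀ x, 0 ≤ V x) {u : E N → ℝ}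
    (hu : MemEnergySpace p q V u) {k : ℝ} (hk : 0 ≤ k) :
    MemEnergySpace p q V (truncTest u k ζ) := by
  have hq := hp.trans hpq
  have h1 := hζ.memW1_truncTest hq hK hp.le hu.memW1_p hk
  refine ⟨h1, hζ.memW1_truncTest hq hK hq.le hu.memW1_q hk, ?_⟩
  refine hu.integrable_potential.mono ?_ (Eventually.of_forall fun x => ?_)
  · have := h1.memLp.1.aemeasurable.norm
    exact (hVm.aemeasurable.mul ((this.pow_const p).add (this.pow_const q))).aestronglyMeasurable
  · have hx := hV x
    rw [Real.norm_of_nonneg (by positivity), Real.norm_of_nonneg (by positivity)]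
    have := hζ.abs_truncTest_le (u := u) hk x
    gcongr

end IsCutoff

theorem integrable_rpow_mul_inner {s : ℝ} (hs : 1 < s) {G H : E N → E N}
    (hG : MemLp G (ENNReal.ofReal s)) (hH : MemLp H (ENNReal.ofReal s)) :
    Integrable fun x => ‖G x‖ ^ (s - 2) * inner ℝ (G x) (H x) := by
  have s0 : 0 < s := by linarith
  refine (((memLp_iff_integrable_norm_rpow s0 hG.1).1 hG).add
    ((memLp_iff_integrable_norm_rpow s0 hH.1).1 hH)).mono' ?_ (Eventually.of_forall fun x => ?_)
  · exact (hG.1.aemeasurable.norm.pow_const _).aestronglyMeasurable.mul (hG.1.inner hH.1)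
  · rw [norm_mul, Real.norm_of_nonneg (by positivity), Real.norm_eq_abs, Pi.add_apply]
    refine (norm_rpow_mul_abs_inner_le s _ _).trans ?_
    have e : ∀ a : ℝ, 0 ≤ a → a ^ (s - 1) * a = a ^ s := fun a ha => by
      rw [← Real.rpow_add_one' ha (by linarith)]; ring_nf
    have hg := norm_nonneg (G x)
    have hh := norm_nonneg (H x)
    rcases le_total ‖G x‖ ‖H x‖ with h | h
    · calc ‖G x‖ ^ (s - 1) * ‖H x‖ ≤ ‖H x‖ ^ (s - 1) * ‖H x‖ := by
            gcongr
        _ = ‖H x‖ ^ s := e _ hh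
        _ ≤ _ := le_add_of_nonneg_left (by positivity)
    · calc ‖G x‖ ^ (s - 1) * ‖H x‖ ≤ ‖G x‖ ^ (s - 1) * ‖G x‖ := by gcongr
        _ = ‖G x‖ ^ s := e _ hg
        _ ≤ _ := le_add_of_nonneg_right (by positivity)

theorem ae_eq_truncGrad {q K : ℝ} {ζ : E N → ℝ} (hζ : IsCutoff q K ζ) (hq : 1 < q) {u : E N → ℝ}
    (hu : MemW1 q u) (k : ℝ) :
    weakGrad (truncTest u k ζ) =ᵐ[volume] truncGrad u (weakGrad u) k ζ :=
  (hζ.isWeakGradient_truncTest hq.le hu k).weakGrad_ae_eq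

theorem MemW1.integrable_abs_rpow_self {s : ℝ} (hs : 0 < s) {u : E N → ℝ} (hu : MemW1 s u) :
    Integrable fun x => |u x| ^ s :=
  (memLp_iff_integrable_norm_rpow hs hu.memLp.1).1 hu.memLp

theorem MemW1.integrable_norm_grad_rpow {s : ℝ} (hs : 0 < s) {u : E N → ℝ} (hu : MemW1 s u) :
    Integrable fun x => ‖weakGrad u x‖ ^ s :=
  (memLp_iff_integrable_norm_rpow hs hu.memLp_grad.1).1 hu.memLp_grad

theorem abs_rpow_sub_two_mul_self {s : ℝ} (hs : 1 < s) (t : ℝ) :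
    |t| ^ (s - 2) * |t| * |t| = |t| ^ s := by
  rcases (abs_nonneg t).eq_or_lt with h | h
  · rw [← h, mul_zero, Real.zero_rpow (by linarith)]
  · rw [← Real.rpow_add_one h.ne', ← Real.rpow_add_one h.ne']; ring_nf

theorem integrable_max_sub_rpow {q r : ℝ} (hq : 1 < q) (hqN : q < N) (hqr : q ≤ r)
    (hr : r ≤ critExp N q) {u : E N → ℝ} (hu : MemW1 q u) {k : ℝ} (hk : 0 ≤ k) :
    Integrable fun x => max (u x - k) 0 ^ r := by
  refine (hu.integrable_abs_rpow hq.le hqN hqr hr).mono'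
    (((hu.memLp.1.aemeasurable.sub_const k).max aemeasurable_const).pow_const
      r).aestronglyMeasurable (Eventually.of_forall fun x => ?_)
  have := max_sub_le_abs (t := u x) hk
  rw [Real.norm_of_nonneg (by positivity)]
  exact Real.rpow_le_rpow (le_max_right _ _) this (by linarith)

/-- The domination `|φ| ≤ |u|` bounds the integrand by the potential energy density of `u`; no upper
bound on `V` is needed. -/
theorem integrable_potential_mul {p q : ℝ} (hp : 1 < p) (hpq : p < q) {V : E N → ℝ}
    (hVm : Measurable V) (hV : ∀ x, 0 ≤ V x) {u φ : E N → ℝ} (hu : MemEnergySpace p q V u)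
    (hφm : AEStronglyMeasurable φ) (hφ : ∀ x, |φ x| ≤ |u x|) :
    Integrable fun x => V x * (|u x| ^ (p - 2) * u x + |u x| ^ (q - 2) * u x) * φ x := by
  have hum := hu.memW1_p.memLp.1.aemeasurable
  refine hu.integrable_potential.mono' ?_ (Eventually.of_forall fun x => ?_)
  · exact ((hVm.aemeasurable.mul (((hum.norm.pow_const _).mul hum).add
      ((hum.norm.pow_const _).mul hum))).mul hφm.aemeasurable).aestronglyMeasurable
  · have hx := hV x
    rw [norm_mul, norm_mul, Real.norm_of_nonneg hx, mul_assoc, Real.norm_eq_abs, Real.norm_eq_abs]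
    gcongr
    rw [← abs_rpow_sub_two_mul_self hp, ← abs_rpow_sub_two_mul_self (hp.trans hpq),
      ← add_mul (|u x| ^ (p - 2) * |u x|)]
    refine mul_le_mul ?_ (hφ x) (abs_nonneg _) (by positivity)
    · refine (abs_add_le _ _).trans ?_
      rw [abs_mul, abs_mul, abs_of_nonneg (a := |u x| ^ (p - 2)) (by positivity),
        abs_of_nonneg (a := |u x| ^ (q - 2)) (by positivity)]

theorem integrable_nonlinearity_mul {p q r V₀ C : ℝ} (hp : 1 < p) (hq : 1 < q) (hqN : q < N)
    (hqr : q ≤ r) (hr : r ≤ critExp N q) {f : ℝ → ℝ} (hfc : Continuous f)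
    (hf : ∀ t : ℝ, 0 < t → |f t| ≤ V₀ * t ^ (p - 1) + C * t ^ (r - 1))
    {u φ : E N → ℝ} (hup : MemW1 p u) (huq : MemW1 q u) (hpos : ∀ᵐ x, 0 < u x)
    (hφm : AEStronglyMeasurable φ) (hφ : ∀ x, |φ x| ≤ |u x|) :
    Integrable fun x => f (u x) * φ x := by
  refine (((hup.integrable_abs_rpow_self (by linarith)).const_mul V₀).add
    ((huq.integrable_abs_rpow hq.le hqN hqr hr).const_mul C)).mono'
    ((hfc.comp_aestronglyMeasurable hup.memLp.1).mul hφm) ?_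
  filter_upwards [hpos] with x hx
  have e : ∀ s : ℝ, u x ^ (s - 1) * u x = u x ^ s := fun s => by
    rw [← Real.rpow_add_one hx.ne']; ring_nf
  have h1 := hφ x
  rw [norm_mul, Pi.add_apply, Real.norm_eq_abs, Real.norm_eq_abs]
  rw [abs_of_pos hx] at h1 ⊢
  calc |f (u x)| * |φ x| ≤ (V₀ * u x ^ (p - 1) + C * u x ^ (r - 1)) * u x :=
        mul_le_mul (hf _ hx) h1 (abs_nonneg _) ((abs_nonneg _).trans (hf _ hx))
    _ = _ := by rw [← e p, ← e r]; ring

/-! ### Caccioppoli estimate and De Giorgi iteration -/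

/-- Caccioppoli-type estimate for the truncations of a solution. -/
theorem energy_truncTest_le {p q r V₀ C K Λ k h : ℝ} (hp : 1 < p) (hpq : p < q) (hqN : q < N)
    (hqr : q < r) (hr : r ≤ critExp N q) (hV₀ : 0 < V₀) (hC : 0 < C) {f : ℝ → ℝ}
    (hfc : Continuous f) (hf : ∀ t : ℝ, 0 < t → |f t| ≤ V₀ * t ^ (p - 1) + C * t ^ (r - 1))
    {V : E N → ℝ} (hVm : Measurable V) (hV : ∀ x, V₀ ≤ V x) {u : E N → ℝ}
    (hu : IsPositiveWeakSolution p q V f u) {ζ : E N → ℝ} (hζ : IsCutoff q K ζ)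
    (hK : 0 ≤ K) (hKΛ : K ≤ Λ) (hk : 0 ≤ k) (hh : 0 < h) (hΛh : 1 ≤ Λ * h) (hkh : k + h ≤ Λ * h) :
    (∫ x, ‖weakGrad (truncTest u (k + h) ζ) x‖ ^ q) + ∫ x, |truncTest u (k + h) ζ x| ^ q ≤
      (2 ^ q * (2 * (2 ^ (p - 1) + 2 ^ (q - 1) + C) + 1) + 1) * Λ ^ r *
        ∫ x in {x | 0 < ζ x}, max (u x - k) 0 ^ r := by
  have hq := hp.trans hpq
  have q0 : 0 < q := by linarith
  have hkh0 : 0 ≤ k + h := by positivity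
  have hΛ1 : 1 ≤ Λ := by nlinarith
  have hV0 : ∀ x, 0 ≤ V x := fun x => hV₀.le.trans (hV x)
  set φ := truncTest u (k + h) ζ with hφdef
  have hφE := hζ.memEnergySpace_truncTest hp hpq hK hVm hV0 hu.mem hkh0
  have hφm := hφE.memW1_p.memLp.1
  have hφu : ∀ x, |φ x| ≤ |u x| := hζ.abs_truncTest_le hkh0
  have hgr := ae_eq_truncGrad hζ hq hu.mem.memW1_q (k + h)
  set D := (2 : ℝ) ^ (p - 1) + 2 ^ (q - 1) + C with hD
  set S := {x | 0 < ζ x}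
  have hS : MeasurableSet S := (isOpen_lt continuous_const hζ.contDiff.continuous).measurableSet
  set I : E N → ℝ := fun x => if 0 < ζ x then Λ ^ r * max (u x - k) 0 ^ r else 0 with hI
  have hIind : I = S.indicator fun x => Λ ^ r * max (u x - k) 0 ^ r := by
    ext x; simp [I, S, Set.indicator_apply]
  have hIint : Integrable I := by
    rw [hIind]
    exact ((integrable_max_sub_rpow hq hqN hqr.le hr hu.mem.memW1_q hk).const_mul _).indicator hS
  have hIval : ∫ x, I x = Λ ^ r * ∫ x in S, max (u x - k) 0 ^ r := by
    rw [hIind, integral_indicator hS, integral_const_mul]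
  set T : E N → ℝ := fun x => (if 0 < u x - (k + h) then ‖weakGrad u x‖ ^ q else 0) * ζ x with hT
  have hTint : Integrable T := by
    have h1 := hu.mem.memW1_q.integrable_norm_grad_rpow q0
    have h2 : NullMeasurableSet {x | 0 < u x - (k + h)} :=
      nullMeasurableSet_lt aemeasurable_const (hu.mem.memW1_q.memLp.1.aemeasurable.sub_const _)
    have h3 : Integrable fun x => if 0 < u x - (k + h) then ‖weakGrad u x‖ ^ q else 0 := by
      refine (h1.indicator₀ h2).congr (Eventually.of_forall fun x => ?_)
      simp [Set.indicator_apply]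
    refine h3.mono (h3.1.mul hζ.contDiff.continuous.aestronglyMeasurable)
      (Eventually.of_forall fun x => ?_)
    rw [norm_mul, Real.norm_of_nonneg (hζ.nonneg x)]
    exact mul_le_of_le_one_right (norm_nonneg _) (hζ.le_one x)
  have iA : ∀ s : ℝ, 1 < s → MemW1 s u → MemW1 s φ →
      Integrable fun x => ‖weakGrad u x‖ ^ (s - 2) * inner ℝ (weakGrad u x) (weakGrad φ x) :=
    fun s hs h1 h2 => integrable_rpow_mul_inner hs h1.memLp_grad h2.memLp_grad
  have iAp := iA p hp hu.mem.memW1_p hφE.memW1_p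
  have iAq := iA q hq hu.mem.memW1_q hφE.memW1_q
  have iB := integrable_potential_mul hp hpq hVm hV0 hu.mem hφm hφu
  have iF := integrable_nonlinearity_mul hp hq hqN hqr.le hr hfc hf hu.mem.memW1_p hu.mem.memW1_q
    hu.pos hφm hφu
  have heq := hu.equation φ hφE
  -- The integral of the upper side of `le_weak_integrand` is zero by the equation tested with `φ`.
  have hTI : (∫ x, T x) / 2 ≤ D * ∫ x, I x := by
    have h1 : ∫ x, (T x / 2 - D * I x) ≤ ∫ x, (‖weakGrad u x‖ ^ (p - 2) *
        inner ℝ (weakGrad u x) (weakGrad φ x) + ‖weakGrad u x‖ ^ (q - 2) *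
        inner ℝ (weakGrad u x) (weakGrad φ x)
        + V x * (|u x| ^ (p - 2) * u x + |u x| ^ (q - 2) * u x) * φ x - f (u x) * φ x) := by
      refine integral_mono_ae ((hTint.div_const 2).sub (hIint.const_mul D))
        (((iAp.add iAq).add iB).sub iF) ?_
      filter_upwards [hgr, hu.pos] with x hx hux
      rw [hx]
      exact le_weak_integrand hp hpq hqr (hV x) hV₀ hC hf hK hKΛ hk hh hΛh hkh hux (hζ.nonneg x)
        (hζ.le_one x) _ _ (hζ.norm_gradient_le x)
    rw [integral_sub (hTint.div_const 2) (hIint.const_mul D), integral_div, integral_const_mul,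
      integral_sub (f := fun x => ‖weakGrad u x‖ ^ (p - 2) * inner ℝ (weakGrad u x) (weakGrad φ x)
        + ‖weakGrad u x‖ ^ (q - 2) * inner ℝ (weakGrad u x) (weakGrad φ x)
        + V x * (|u x| ^ (p - 2) * u x + |u x| ^ (q - 2) * u x) * φ x)
        ((iAp.add iAq).add iB) iF,
      integral_add (f := fun x => ‖weakGrad u x‖ ^ (p - 2) * inner ℝ (weakGrad u x) (weakGrad φ x)
        + ‖weakGrad u x‖ ^ (q - 2) * inner ℝ (weakGrad u x) (weakGrad φ x)) (iAp.add iAq) iB,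
      integral_add iAp iAq, heq, sub_self] at h1
    linarith
  have hG : ∫ x, ‖weakGrad φ x‖ ^ q ≤ 2 ^ q * ((∫ x, T x) + ∫ x, I x) := by
    rw [← integral_add hTint hIint, ← integral_const_mul]
    refine integral_mono_ae (hφE.memW1_q.integrable_norm_grad_rpow q0)
      ((hTint.add hIint).const_mul _) ?_
    filter_upwards [hgr] with x hx
    rw [hx]
    exact norm_cutoff_grad_rpow_le hq hqr hK hKΛ hh hΛh (hζ.nonneg x) (hζ.le_one x) _ _
      (hζ.norm_gradient_le x)
  have hφq : ∫ x, |φ x| ^ q ≤ ∫ x, I x :=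
    integral_mono (hφE.memW1_q.integrable_abs_rpow_self q0) hIint fun x =>
      cutoff_rpow_le hq hqr hΛ1 hh hΛh (hζ.nonneg x) (hζ.le_one x)
  rw [mul_assoc, ← hIval]
  have h2q : (0 : ℝ) < 2 ^ q := by positivity
  have h3 : (2 : ℝ) ^ q * ((∫ x, T x) + ∫ x, I x) ≤ 2 ^ q * (2 * (D * ∫ x, I x) + ∫ x, I x) := by
    gcongr; linarith
  linarith

/-- One step of De Giorgi's iteration. -/
theorem exists_deGiorgi_step {p q r V₀ C : ℝ} (hp : 1 < p) (hpq : p < q) (hqN : q < N)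
    (hqr : q < r) (hr : r ≤ critExp N q) (hV₀ : 0 < V₀) (hC : 0 < C) {f : ℝ → ℝ}
    (hfc : Continuous f) (hf : ∀ t : ℝ, 0 < t → |f t| ≤ V₀ * t ^ (p - 1) + C * t ^ (r - 1)) :
    ∃ A : ℝ, 0 < A ∧ ∀ V : E N → ℝ, Measurable V → (∀ x, V₀ ≤ V x) → ∀ u : E N → ℝ,
      IsPositiveWeakSolution p q V f u → ∀ (ζ : E N → ℝ) (K Λ k h : ℝ), IsCutoff q K ζ →
      0 ≤ K → K ≤ Λ → 0 ≤ k → 0 < h → 1 ≤ Λ * h → k + h ≤ Λ * h →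
      ∫ x in {x | ζ x = 1}, max (u x - (k + 2 * h)) 0 ^ r ≤
        A * Λ ^ (critExp N q - r + r * (critExp N q / q)) *
          (∫ x in {x | 0 < ζ x}, max (u x - k) 0 ^ r) ^ (critExp N q / q) := by
  have hq := hp.trans hpq
  have q0 : 0 < q := by linarith
  obtain ⟨C₁, hC₁, hsob⟩ := exists_sobolev_integral_const hq.le hqN
  set D := 2 ^ q * (2 * (2 ^ (p - 1) + 2 ^ (q - 1) + C) + 1) + 1 with hD
  have hD0 : 0 < D := by positivity
  refine ⟨C₁ * D ^ (critExp N q / q), by positivity, ?_⟩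
  intro V hVm hV u hu ζ K Λ k h hζ hK hKΛ hk hh hΛh hkh
  have hΛ1 : 1 ≤ Λ := by nlinarith
  have hΛ0 : 0 < Λ := by linarith
  have hkh0 : 0 ≤ k + h := by positivity
  have c0 := critExp_pos hq.le hqN
  have hE := energy_truncTest_le hp hpq hqN hqr hr hV₀ hC hfc hf hVm hV hu hζ hK hKΛ hk hh hΛh hkh
  have hφ := hζ.memW1_truncTest hq hK hq.le hu.mem.memW1_q hkh0
  obtain ⟨hφc, hφs⟩ := hsob _ hφ
  have hφi := (memLp_iff_integrable_norm_rpow c0 hφc.1).1 hφc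
  set φ := truncTest u (k + h) ζ with hφdef
  set U := ∫ x in {x | 0 < ζ x}, max (u x - k) 0 ^ r with hU
  have hU0 : 0 ≤ U := integral_nonneg fun x => by positivity
  have hm : MeasurableSet {x | ζ x = 1} :=
    (isClosed_eq hζ.contDiff.continuous continuous_const).measurableSet
  -- The second gap pays for the change of exponent: where `u > k + 2h` one has `φ > h`, hence `Λ φ
  -- ≥ 1`, and the `r`-th power is below the `q*`-th times `Λ^(q*-r)`.
  have hpt : ∀ x ∈ {x | ζ x = 1}, max (u x - (k + 2 * h)) 0 ^ r
      ≤ Λ ^ (critExp N q - r) * |φ x| ^ critExp N q := by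
    intro x hx
    have hx' : ζ x = 1 := hx
    by_cases h1 : u x - (k + 2 * h) ≤ 0
    · rw [max_eq_right h1, Real.zero_rpow (by linarith)]
      positivity
    · have h2 : φ x = u x - (k + h) := by
        rw [hφdef, truncTest, hx', mul_one, max_eq_left (by linarith)]
      have h3 : h < φ x := by rw [h2]; linarith
      have hφ0 : 0 < φ x := hh.trans h3
      rw [abs_of_pos hφ0, max_eq_left (by linarith)]
      have h4 : 1 ≤ Λ * φ x := hΛh.trans (by gcongr)
      calc (u x - (k + 2 * h)) ^ r ≤ φ x ^ r :=
            Real.rpow_le_rpow (by linarith) (by linarith) (by linarith)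
        _ ≤ (Λ * φ x) ^ (critExp N q - r) * φ x ^ r :=
            le_mul_of_one_le_left (by positivity) (Real.one_le_rpow h4 (by linarith))
        _ = Λ ^ (critExp N q - r) * φ x ^ critExp N q := by
            rw [Real.mul_rpow hΛ0.le hφ0.le, mul_assoc, ← Real.rpow_add hφ0]
            ring_nf
  calc ∫ x in {x | ζ x = 1}, max (u x - (k + 2 * h)) 0 ^ r
      ≤ ∫ x in {x | ζ x = 1}, Λ ^ (critExp N q - r) * |φ x| ^ critExp N q :=
        setIntegral_mono_on (integrable_max_sub_rpow hq hqN hqr.le hr hu.mem.memW1_q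
          (by positivity)).integrableOn (hφi.const_mul _).integrableOn hm hpt
    _ ≤ ∫ x, Λ ^ (critExp N q - r) * |φ x| ^ critExp N q :=
        setIntegral_le_integral (hφi.const_mul _) (Eventually.of_forall fun x => by
          simp only [Pi.zero_apply]; positivity)
    _ = Λ ^ (critExp N q - r) * ∫ x, |φ x| ^ critExp N q := integral_const_mul _ _
    _ ≤ Λ ^ (critExp N q - r) * (C₁ * (D * Λ ^ r * U) ^ (critExp N q / q)) := by
        gcongr
        refine hφs.trans ?_
        gcongr
    _ = _ := by
        rw [Real.mul_rpow (by positivity) hU0, Real.mul_rpow hD0.le (by positivity),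
          ← Real.rpow_mul hΛ0.le, Real.rpow_add hΛ0]
        ring

/-- Fast geometric convergence. -/
theorem exists_tendsto_zero_of_superlinear_recursion {c b β : ℝ} (hc : 0 < c) (hb : 1 < b)
    (hβ : 1 < β) : ∃ τ : ℝ, 0 < τ ∧ ∀ U : ℕ → ℝ, (∀ j, 0 ≤ U j) → U 0 ≤ τ →
      (∀ j, U (j + 1) ≤ c * b ^ j * U j ^ β) → Tendsto U atTop (𝓝 0) := by
  have hβ' : 0 < β - 1 := by linarith
  have b0 : 0 < b := by linarith
  -- `σ` and `τ` are chosen so that `τ σ^j` solves the recursion with equality: `σ^(β-1) = 1/b`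
  -- cancels `b^j`, and `τ^(β-1) = σ/c` supplies one more factor `σ`.
  set σ : ℝ := b⁻¹ ^ (1 / (β - 1)) with hσ
  have hσ0 : 0 < σ := by positivity
  have hσ1 : σ < 1 := Real.rpow_lt_one (by positivity) (inv_lt_one_of_one_lt₀ hb) (by positivity)
  have hσβ : σ ^ (β - 1) = b⁻¹ := by
    rw [hσ, ← Real.rpow_mul (by positivity), one_div_mul_cancel hβ'.ne', Real.rpow_one]
  set τ : ℝ := (σ / c) ^ (1 / (β - 1)) with hτ
  have hτ0 : 0 < τ := by positivity
  have hτβ : τ ^ (β - 1) = σ / c := by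
    rw [hτ, ← Real.rpow_mul (by positivity), one_div_mul_cancel hβ'.ne', Real.rpow_one]
  refine ⟨τ, hτ0, fun U hU0 hUτ hrec => ?_⟩
  have hle : ∀ j, U j ≤ τ * σ ^ j := by
    intro j
    induction j with
    | zero => simpa using hUτ
    | succ j ih =>
      have h1 : (τ * σ ^ j) ^ β = (σ / c) * b⁻¹ ^ j * (τ * σ ^ j) := by
        have h2 : (σ ^ j) ^ (β - 1) = b⁻¹ ^ j := by
          rw [← Real.rpow_natCast, ← Real.rpow_mul hσ0.le, mul_comm, Real.rpow_mul hσ0.le, hσβ,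
            Real.rpow_natCast]
        rw [show β = (β - 1) + 1 by ring, Real.rpow_add_one (by positivity),
          Real.mul_rpow hτ0.le (by positivity), hτβ, h2]
      calc U (j + 1) ≤ c * b ^ j * U j ^ β := hrec j
        _ ≤ c * b ^ j * (τ * σ ^ j) ^ β := by
          gcongr
          exact hU0 j
        _ = τ * σ ^ (j + 1) := by
          rw [h1, inv_pow]
          field_simp
          ring
  have h3 : Tendsto (fun j : ℕ => τ * σ ^ j) atTop (𝓝 0) := by
    simpa using (tendsto_pow_atTop_nhds_zero_of_lt_one hσ0.le hσ1).const_mul τ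
  exact squeeze_zero hU0 hle h3

/-- De Giorgi's lemma: a solution whose truncation at level `κ / 2` is small in `L^r` on the
support of the first cutoff is bounded by `κ` where no cutoff vanishes. -/
theorem exists_deGiorgi_threshold {p q r V₀ C : ℝ} (hp : 1 < p) (hpq : p < q) (hqN : q < N)
    (hqr : q < r) (hr : r ≤ critExp N q) (hV₀ : 0 < V₀) (hC : 0 < C) {f : ℝ → ℝ}
    (hfc : Continuous f) (hf : ∀ t : ℝ, 0 < t → |f t| ≤ V₀ * t ^ (p - 1) + C * t ^ (r - 1))
    {K κ₀ : ℝ} (hK : 0 ≤ K) (hκ₀ : 0 < κ₀) :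
    ∃ τ : ℝ, 0 < τ ∧ ∀ V : E N → ℝ, Measurable V → (∀ x, V₀ ≤ V x) → ∀ u : E N → ℝ,
      IsPositiveWeakSolution p q V f u → ∀ ζ : ℕ → E N → ℝ,
      (∀ j, IsCutoff q (K * 2 ^ j) (ζ j)) → (∀ j x, 0 < ζ (j + 1) x → ζ j x = 1) →
      ∀ κ : ℝ, κ₀ ≤ κ → ∫ x in {x | 0 < ζ 0 x}, max (u x - κ / 2) 0 ^ r ≤ τ →
      ∀ᵐ x, (∀ j, 0 < ζ j x) → u x ≤ κ := by
  have hq := hp.trans hpq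
  have c0 := critExp_pos hq.le hqN
  obtain ⟨A, hA, hstep⟩ := exists_deGiorgi_step hp hpq hqN hqr hr hV₀ hC hfc hf
  set m := critExp N q - r + r * (critExp N q / q) with hm
  have hm0 : 0 < m := by
    have : 0 < r * (critExp N q / q) := mul_pos (by linarith) (div_pos c0 (by linarith))
    linarith
  -- At step `j` the scale is `Λ 2^j`, so `Λ 2^j h j = Λ κ / 8`. Then `8 / κ₀` ensures that this is
  -- at least `1`, `8` that it is at least `κ ≥ k j + h j`, and `K` dominates the cutoff gradients.
  set Λ : ℝ := max (max 8 (8 / κ₀)) K with hΛ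
  have hΛ8 : 8 ≤ Λ := (le_max_left _ _).trans (le_max_left _ _)
  have hΛκ : 8 / κ₀ ≤ Λ := (le_max_right _ _).trans (le_max_left _ _)
  have hΛK : K ≤ Λ := le_max_right _ _
  have hΛ0 : 0 < Λ := by linarith
  have hβ : 1 < critExp N q / q := by
    rw [one_lt_div (by linarith)]; exact lt_critExp hq.le hqN
  obtain ⟨τ, hτ, hrec⟩ := exists_tendsto_zero_of_superlinear_recursion (c := A * Λ ^ m)
    (b := 2 ^ m) (by positivity) (Real.one_lt_rpow (by norm_num) hm0) hβ
  refine ⟨τ, hτ, fun V hVm hV u hu ζ hζ hnest κ hκ hsmall => ?_⟩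
  have hκ0 : 0 < κ := by linarith
  -- Levels rise from `κ / 2` to `κ`; each increment is split into two gaps `h j`, one for
  -- Caccioppoli and one for the change of exponent.
  set k : ℕ → ℝ := fun j => κ * (1 - 1 / 2 ^ (j + 1)) with hk
  set h : ℕ → ℝ := fun j => κ / 2 ^ (j + 3) with hh
  have hkh : ∀ j, k (j + 1) = k j + 2 * h j := fun j => by
    simp only [hk, hh]; field_simp; ring
  have hk0 : ∀ j, 0 ≤ k j := fun j => by
    have : (1 : ℝ) / 2 ^ (j + 1) ≤ 1 := by
      rw [div_le_one (by positivity)]; exact one_le_pow₀ (by norm_num)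
    exact mul_nonneg hκ0.le (by linarith)
  have hkκ : ∀ j, k j ≤ κ := fun j => by
    have : (0 : ℝ) < 1 / 2 ^ (j + 1) := by positivity
    exact mul_le_of_le_one_right hκ0.le (by linarith)
  set S : ℕ → Set (E N) := fun j => {x | 0 < ζ j x} with hS
  have hSm : ∀ j, MeasurableSet (S j) := fun j =>
    (isOpen_lt continuous_const (hζ j).contDiff.continuous).measurableSet
  set U : ℕ → ℝ := fun j => ∫ x in S j, max (u x - k j) 0 ^ r with hU
  have hint : ∀ c : ℝ, 0 ≤ c → Integrable fun x => max (u x - c) 0 ^ r := fun c hc =>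
    integrable_max_sub_rpow hq hqN hqr.le hr hu.mem.memW1_q hc
  have hnn : ∀ c : ℝ, ∀ x, 0 ≤ max (u x - c) 0 ^ r := fun c x => by positivity
  have hU0 : ∀ j, 0 ≤ U j := fun j => integral_nonneg (hnn _)
  have hlim : Tendsto U atTop (𝓝 0) := by
    refine hrec U hU0 ?_ fun j => ?_
    · have : k 0 = κ / 2 := by simp only [hk]; norm_num; ring
      simpa only [hU, this] using hsmall
    · have h2 : (1 : ℝ) ≤ 2 ^ j := one_le_pow₀ (by norm_num)
      have e : Λ * 2 ^ j * h j = Λ * κ / 8 := by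
        simp only [hh, pow_add]; field_simp; norm_num
      have hΛκ' : 8 ≤ Λ * κ := by
        rw [div_le_iff₀ hκ₀] at hΛκ
        exact hΛκ.trans (by gcongr)
      have h3 := hstep V hVm hV u hu (ζ j) (K * 2 ^ j) (Λ * 2 ^ j) (k j) (h j) (hζ j)
        (by positivity) (by gcongr) (hk0 j) (by positivity) (by rw [e]; linarith) (by
          have := hkh j
          have h5 := hkκ (j + 1)
          have h6 : 0 < h j := by positivity
          rw [e]
          nlinarith)
      have h4 : (Λ * 2 ^ j) ^ m = Λ ^ m * (2 ^ m) ^ j := by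
        rw [Real.mul_rpow hΛ0.le (by positivity), ← Real.rpow_natCast, ← Real.rpow_natCast,
          ← Real.rpow_mul (by norm_num), ← Real.rpow_mul (by norm_num), mul_comm (j : ℝ)]
      rw [h4] at h3
      calc U (j + 1) ≤ ∫ x in {x | ζ j x = 1}, max (u x - (k j + 2 * h j)) 0 ^ r := by
            simp only [hU, ← hkh]
            exact setIntegral_mono_set (hint _ (hk0 _)).integrableOn
              (Eventually.of_forall (hnn _)) (Eventually.of_forall fun x hx => hnest j x hx)
        _ ≤ _ := by rw [mul_assoc A]; exact h3
  -- On the common positivity set every `U j` dominates the excess over `κ`, which therefore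
  -- vanishes.
  set T := ⋂ j, S j with hT
  have hTm : MeasurableSet T := MeasurableSet.iInter hSm
  have hTU : ∀ j, ∫ x in T, max (u x - κ) 0 ^ r ≤ U j := fun j => by
    refine (setIntegral_mono_set (hint κ hκ0.le).integrableOn (Eventually.of_forall (hnn _))
      (Eventually.of_forall fun x hx => Set.mem_iInter.1 hx j)).trans ?_
    refine integral_mono (hint κ hκ0.le).integrableOn (hint _ (hk0 j)).integrableOn fun x => ?_
    have := hkκ j
    dsimp only
    gcongr
    linarith
  have hzero : ∫ x in T, max (u x - κ) 0 ^ r = 0 :=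
    le_antisymm (ge_of_tendsto' hlim hTU) (integral_nonneg (hnn _))
  rw [integral_eq_zero_iff_of_nonneg (hnn κ) (hint κ hκ0.le).integrableOn,
    EventuallyEq, ae_restrict_iff' hTm] at hzero
  filter_upwards [hzero] with x hx hxT
  have h1 := hx (Set.mem_iInter.2 hxT)
  by_contra hlt
  have h2 : 0 < max (u x - κ) 0 := lt_max_of_lt_left (by linarith)
  exact (Real.rpow_pos_of_pos h2 r).ne' h1

/-! ### Construction of cutoffs -/

theorem isCutoff_const_one {q : ℝ} : IsCutoff q 0 (fun _ : E N => (1 : ℝ)) where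
  contDiff := contDiff_const
  nonneg _ := zero_le_one
  le_one _ := le_rfl
  norm_gradient_le x := by rw [norm_gradient]; simp

/-- With `m = ⌈q⌉` the gradient of `g^m` carries `g^(m-1)`, and `m - 1 ≥ m (1 - 1/q)` because `m ≥
q`. A natural exponent keeps the power smooth where `g` vanishes. -/
theorem isCutoff_pow {q L : ℝ} (hq : 1 < q) {g : E N → ℝ} (hg : ContDiff ℝ ∞ g)
    (h0 : ∀ x, 0 ≤ g x) (h1 : ∀ x, g x ≤ 1) (hL : ∀ x, ‖fderiv ℝ g x‖ ≤ L) :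
    IsCutoff q (⌈q⌉₊ * L) (fun x => g x ^ ⌈q⌉₊) where
  contDiff := hg.pow _
  nonneg x := pow_nonneg (h0 x) _
  le_one x := pow_le_one₀ (h0 x) (h1 x)
  norm_gradient_le x := by
    have hqm : q ≤ ⌈q⌉₊ := Nat.le_ceil q
    have hm : 0 < ⌈q⌉₊ := Nat.ceil_pos.2 (by linarith)
    have hd : fderiv ℝ (fun x => g x ^ ⌈q⌉₊) x = (⌈q⌉₊ * g x ^ (⌈q⌉₊ - 1)) • fderiv ℝ g x := by
      rw [fderiv_fun_pow _ (hg.differentiable (by simp) x)]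
      simp
    have hL0 : 0 ≤ L := (norm_nonneg _).trans (hL x)
    have hpow : g x ^ (⌈q⌉₊ - 1) ≤ (g x ^ ⌈q⌉₊) ^ (1 - 1 / q) := by
      rw [← Real.rpow_natCast, ← Real.rpow_natCast, ← Real.rpow_mul (h0 x), Nat.cast_sub hm,
        Nat.cast_one]
      have hexp : (⌈q⌉₊ : ℝ) * (1 - 1 / q) ≤ ⌈q⌉₊ - 1 := by
        have : 1 ≤ (⌈q⌉₊ : ℝ) * (1 / q) := by
          rw [mul_one_div, one_le_div (by linarith)]; exact hqm
        linarith
      rcases (h0 x).eq_or_lt with h | h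
      · rw [← h, Real.zero_rpow (by linarith)]
        positivity
      · exact Real.rpow_le_rpow_of_exponent_ge h (h1 x) hexp
    rw [norm_gradient, hd, norm_smul, Real.norm_of_nonneg
      (mul_nonneg (Nat.cast_nonneg _) (pow_nonneg (h0 x) _))]
    calc (⌈q⌉₊ : ℝ) * g x ^ (⌈q⌉₊ - 1) * ‖fderiv ℝ g x‖
        ≤ ⌈q⌉₊ * (g x ^ ⌈q⌉₊) ^ (1 - 1 / q) * L := by
          have := pow_nonneg (h0 x) ⌈q⌉₊
          gcongr
          exact hL x
      _ = _ := by ring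

/-- Exterior cutoffs: nested, vanishing on `{‖x‖ ≤ R}` and equal to `1` on `{2R ≤ ‖x‖}`. -/
theorem exists_exterior_cutoffs {q : ℝ} (hq : 1 < q) : ∃ K : ℝ, 0 ≤ K ∧ ∀ R : ℝ, 1 ≤ R →
    ∃ ζ : ℕ → E N → ℝ, (∀ j, IsCutoff q (K * 2 ^ j) (ζ j)) ∧
      (∀ j x, 0 < ζ (j + 1) x → ζ j x = 1) ∧ (∀ x, 0 < ζ 0 x → R < ‖x‖) ∧
      ∀ j x, 2 * R ≤ ‖x‖ → 0 < ζ j x := by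
  obtain ⟨C, hC, hcut⟩ := exists_norm_fderiv_radialCutoff_le
  refine ⟨⌈q⌉₊ * (C * 8), by positivity, fun R hR => ?_⟩
  have hm : ⌈q⌉₊ ≠ 0 := (Nat.ceil_pos.2 (by linarith)).ne'
  -- Squared radii increasing from `R²` towards `2R² ≤ (2R)²`. Their gaps `R² / 2^(j+1)` give
  -- gradients at most `C · 8 · 2^j / R`, whence the factor `8` and the use of `R ≥ 1`.
  set a : ℕ → ℝ := fun j => R ^ 2 * (2 - 1 / 2 ^ j) with ha
  have hdiff : ∀ j, a (j + 1) - a j = R ^ 2 / 2 ^ (j + 1) := fun j => by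
    simp only [ha]; field_simp; ring
  have hab : ∀ j, a j < a (j + 1) := fun j => by
    have : 0 < a (j + 1) - a j := by rw [hdiff]; positivity
    linarith
  have ha2 : ∀ j, a j ≤ (2 * R) ^ 2 := fun j => by
    have : (0 : ℝ) < 1 / 2 ^ j := by positivity
    simp only [ha]
    nlinarith [sq_nonneg R]
  have hzero : ∀ j (x : E N), ‖x‖ ^ 2 ≤ a j → radialCutoff N (a j) (a (j + 1)) x ^ ⌈q⌉₊ = 0 :=
    fun j x hx => by rw [radialCutoff_eq_zero (hab j) hx, zero_pow hm]
  have hone : ∀ j (x : E N), a (j + 1) ≤ ‖x‖ ^ 2 →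
      radialCutoff N (a j) (a (j + 1)) x ^ ⌈q⌉₊ = 1 :=
    fun j x hx => by rw [radialCutoff_eq_one (hab j) hx, one_pow]
  refine ⟨fun j x => radialCutoff N (a j) (a (j + 1)) x ^ ⌈q⌉₊, fun j => ?_, fun j x hx => ?_,
    fun x hx => ?_, fun j x hx => ?_⟩
  · rw [mul_assoc]
    refine isCutoff_pow hq (contDiff_radialCutoff _ _ _) (radialCutoff_nonneg _ _)
      (radialCutoff_le_one _ _) fun x => (hcut N _ _ (hab j) x).trans ?_
    rw [mul_assoc]
    gcongr
    have h1 : √(a (j + 1)) ≤ 2 * R := Real.sqrt_le_iff.2 ⟨by positivity, ha2 _⟩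
    rw [hdiff, div_le_iff₀ (by positivity), pow_succ 2 j]
    have h2 : (8 : ℝ) * 2 ^ j * (R ^ 2 / (2 ^ j * 2)) = 4 * R ^ 2 := by field_simp; norm_num
    rw [h2]
    nlinarith
  · refine hone j x ?_
    by_contra hlt
    exact hx.ne' (hzero (j + 1) x (not_le.1 hlt).le)
  · by_contra hlt
    have h1 : ‖x‖ ^ 2 ≤ a 0 := by
      simp only [ha]
      norm_num
      exact pow_le_pow_left₀ (norm_nonneg x) (not_lt.1 hlt) 2
    exact hx.ne' (hzero 0 x h1)
  · dsimp only
    rw [hone j x ((ha2 _).trans (pow_le_pow_left₀ (by positivity) hx 2))]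
    exact one_pos

/-! ### Consequences of convergence in `W^{1,q}` -/

theorem tendsto_w1Norm_integral {s : ℝ} (hs : 0 < s) {d : ℕ → E N → ℝ} (hd : ∀ n, MemW1 s (d n))
    (h : Tendsto (fun n => w1Norm s (d n)) atTop (𝓝 0)) :
    Tendsto (fun n => (∫ x, ‖weakGrad (d n) x‖ ^ s) + ∫ x, |d n x| ^ s) atTop (𝓝 0) := by
  have h1 : Tendsto (fun n => w1Norm s (d n) ^ s) atTop (𝓝 0) := by
    simpa [ENNReal.zero_rpow_of_pos hs] using h.ennrpow_const s
  have h2 := (ENNReal.tendsto_toReal ENNReal.zero_ne_top).comp h1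
  rw [ENNReal.toReal_zero] at h2
  refine h2.congr fun n => ?_
  rw [Function.comp_apply, (hd n).w1Norm_rpow hs, ENNReal.toReal_ofReal]
  exact add_nonneg (integral_nonneg fun x => by positivity) (integral_nonneg fun x => by positivity)

theorem tendsto_integral_critExp {q : ℝ} (hq : 1 ≤ q) (hqN : q < N) {d : ℕ → E N → ℝ}
    (hd : ∀ n, MemW1 q (d n)) (h : Tendsto (fun n => w1Norm q (d n)) atTop (𝓝 0)) :
    Tendsto (fun n => ∫ x, |d n x| ^ critExp N q) atTop (𝓝 0) := by
  obtain ⟨C, hC, hsob⟩ := exists_sobolev_integral_const hq hqN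
  have q0 : 0 < q := by linarith
  have hβ : 0 < critExp N q / q := div_pos (critExp_pos hq hqN) q0
  have h1 := ((tendsto_w1Norm_integral q0 hd h).rpow_const (p := critExp N q / q)
    (Or.inr hβ.le)).const_mul C
  rw [Real.zero_rpow hβ.ne', mul_zero] at h1
  exact squeeze_zero (fun n => integral_nonneg fun x => by positivity)
    (fun n => (hsob _ (hd n)).2) h1

/-- Intermediate powers are controlled by the endpoints through `t^r ≤ t^q + t^(q*)`, in place of
Hölder interpolation. -/
theorem tendsto_integral_abs_rpow {q r : ℝ} (hq : 1 ≤ q) (hqN : q < N) (hqr : q ≤ r)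
    (hr : r ≤ critExp N q) {d : ℕ → E N → ℝ}
    (hd : ∀ n, MemW1 q (d n)) (h : Tendsto (fun n => w1Norm q (d n)) atTop (𝓝 0)) :
    Tendsto (fun n => ∫ x, |d n x| ^ r) atTop (𝓝 0) := by
  have q0 : 0 < q := by linarith
  have h1 : Tendsto (fun n => ∫ x, |d n x| ^ q) atTop (𝓝 0) :=
    squeeze_zero (fun n => integral_nonneg fun x => by positivity)
      (fun n => le_add_of_nonneg_left (integral_nonneg fun x => by positivity))
      (tendsto_w1Norm_integral q0 hd h)
  have h2 := h1.add (tendsto_integral_critExp hq hqN hd h)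
  rw [add_zero] at h2
  refine squeeze_zero (fun n => integral_nonneg fun x => by positivity) (fun n => ?_) h2
  have i1 := (hd n).integrable_abs_rpow_self q0
  have i2 := (hd n).integrable_abs_rpow hq hqN (lt_critExp hq hqN).le le_rfl
  rw [← integral_add i1 i2]
  exact integral_mono ((hd n).integrable_abs_rpow hq hqN hqr hr) (i1.add i2) fun x =>
    rpow_le_add_rpow (abs_nonneg _) q0 hqr hr

theorem abs_rpow_le_two_mul_sub {s a b : ℝ} (hs : 0 ≤ s) :
    |a| ^ s ≤ 2 ^ s * (|a - b| ^ s + |b| ^ s) := by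
  refine le_trans ?_ (add_rpow_le_two_mul hs (abs_nonneg _) (abs_nonneg _))
  refine Real.rpow_le_rpow (abs_nonneg _) ?_ hs
  simpa using abs_add_le (a - b) b

theorem tendsto_setIntegral_norm_gt {g : E N → ℝ} (hg : Integrable g) :
    Tendsto (fun R : ℝ => ∫ x in {x | R < ‖x‖}, g x) atTop (𝓝 0) := by
  have hm : ∀ R : ℝ, MeasurableSet {x : E N | R < ‖x‖} := fun R =>
    (isOpen_lt continuous_const continuous_norm).measurableSet
  have h : Tendsto (fun R : ℝ => ∫ x, {x : E N | R < ‖x‖}.indicator g x) atTop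
      (𝓝 (∫ _ : E N, (0 : ℝ))) := by
    refine tendsto_integral_filter_of_dominated_convergence (fun x => ‖g x‖)
      (Eventually.of_forall fun R => (hg.indicator (hm R)).1)
      (Eventually.of_forall fun R => Eventually.of_forall fun x => norm_indicator_le_norm_self _ _)
      hg.norm (Eventually.of_forall fun x => ?_)
    refine tendsto_const_nhds.congr' ?_
    filter_upwards [eventually_ge_atTop ‖x‖] with R hR
    rw [Set.indicator_of_notMem]
    exact not_lt.2 hR
  rw [integral_zero] at h
  exact h.congr fun R => integral_indicator (hm R)

/-- A sequence converging in `W^{1,q}` is uniformly tight in `L^r`, `q ≤ r ≤ q*`. -/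
theorem exists_uniform_tail {q r : ℝ} (hq : 1 ≤ q) (hqN : q < N) (hqr : q ≤ r)
    (hr : r ≤ critExp N q) {v : ℕ → E N → ℝ} {w : E N → ℝ} (hv : ∀ n, MemW1 q (v n))
    (hw : MemW1 q w) (h : Tendsto (fun n => w1Norm q (v n - w)) atTop (𝓝 0)) {τ : ℝ}
    (hτ : 0 < τ) : ∃ R : ℝ, 1 ≤ R ∧ ∀ n, ∫ x in {x | R < ‖x‖}, |v n x| ^ r ≤ τ := by
  have hd : ∀ n, MemW1 q (v n - w) := fun n => (hv n).sub hw
  have hi : ∀ g : E N → ℝ, MemW1 q g → Integrable fun x => |g x| ^ r := fun g hg =>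
    hg.integrable_abs_rpow hq hqN hqr hr
  have r0 : 0 ≤ r := by linarith
  set c : ℝ := τ / (2 * 2 ^ r) with hc
  have hc0 : 0 < c := by positivity
  -- For `n ≥ n₀` the tail is that of the limit plus a small error; the finitely many remaining
  -- functions each have their own small tail.
  obtain ⟨n₀, hn₀⟩ := eventually_atTop.1
    ((tendsto_integral_abs_rpow hq hqN hqr hr hd h).eventually (ge_mem_nhds hc0))
  have e1 : ∀ᶠ R : ℝ in atTop, ∀ n ∈ Set.Iio n₀, ∫ x in {x | R < ‖x‖}, |v n x| ^ r ≤ τ :=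
    (eventually_all_finite (Set.finite_Iio n₀)).2 fun n _ =>
      (tendsto_setIntegral_norm_gt (hi _ (hv n))).eventually (ge_mem_nhds hτ)
  have e2 := (tendsto_setIntegral_norm_gt (hi _ hw)).eventually (ge_mem_nhds hc0)
  obtain ⟨R, ⟨h1, h2⟩, hR⟩ := ((e1.and e2).and (eventually_ge_atTop 1)).exists
  refine ⟨R, hR, fun n => ?_⟩
  rcases lt_or_ge n n₀ with hn | hn
  · exact h1 n hn
  have i1 := (hi _ (hd n)).integrableOn (s := {x | R < ‖x‖})
  have i2 := (hi _ hw).integrableOn (s := {x | R < ‖x‖})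
  calc ∫ x in {x | R < ‖x‖}, |v n x| ^ r
      ≤ ∫ x in {x | R < ‖x‖}, 2 ^ r * (|(v n - w) x| ^ r + |w x| ^ r) :=
        integral_mono (hi _ (hv n)).integrableOn ((i1.add i2).const_mul _) fun x =>
          abs_rpow_le_two_mul_sub r0
    _ = 2 ^ r * ((∫ x in {x | R < ‖x‖}, |(v n - w) x| ^ r) + ∫ x in {x | R < ‖x‖}, |w x| ^ r) := by
        rw [integral_const_mul, integral_add i1 i2]
    _ ≤ 2 ^ r * (c + c) := by
        gcongr
        exact (setIntegral_le_integral (hi _ (hd n))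
          (Eventually.of_forall fun x => by simp only [Pi.zero_apply]; positivity)).trans (hn₀ n hn)
    _ = τ := by rw [hc]; field_simp; norm_num

/-- A sequence converging in `W^{1,q}` is bounded in `L^{q*}`. -/
theorem exists_integral_critExp_bound {q : ℝ} (hq : 1 ≤ q) (hqN : q < N) {v : ℕ → E N → ℝ}
    {w : E N → ℝ} (hv : ∀ n, MemW1 q (v n)) (hw : MemW1 q w)
    (h : Tendsto (fun n => w1Norm q (v n - w)) atTop (𝓝 0)) :
    ∃ B : ℝ, 0 ≤ B ∧ ∀ n, ∫ x, |v n x| ^ critExp N q ≤ B := by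
  have hd : ∀ n, MemW1 q (v n - w) := fun n => (hv n).sub hw
  have hi : ∀ g : E N → ℝ, MemW1 q g → Integrable fun x => |g x| ^ critExp N q := fun g hg =>
    hg.integrable_abs_rpow hq hqN (lt_critExp hq hqN).le le_rfl
  obtain ⟨B, hB⟩ := (tendsto_integral_critExp hq hqN hd h).bddAbove_range
  have hBn : ∀ n, ∫ x, |(v n - w) x| ^ critExp N q ≤ B := fun n => hB ⟨n, rfl⟩
  have hle : ∀ n, ∫ x, |v n x| ^ critExp N q
      ≤ 2 ^ critExp N q * (B + ∫ x, |w x| ^ critExp N q) := fun n =>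
    calc ∫ x, |v n x| ^ critExp N q
        ≤ ∫ x, 2 ^ critExp N q * (|(v n - w) x| ^ critExp N q + |w x| ^ critExp N q) :=
          integral_mono (hi _ (hv n)) (((hi _ (hd n)).add (hi _ hw)).const_mul _) fun x =>
            abs_rpow_le_two_mul_sub (critExp_pos hq hqN).le
      _ = 2 ^ critExp N q * ((∫ x, |(v n - w) x| ^ critExp N q)
          + ∫ x, |w x| ^ critExp N q) := by
          rw [integral_const_mul, integral_add (hi _ (hd n)) (hi _ hw)]
      _ ≤ _ := by gcongr; exact hBn n
  exact ⟨_, (integral_nonneg fun x => by positivity).trans (hle 0), hle⟩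

/-- Chebyshev's argument: where `u > L`, the factor `L^(q*-r)` is at most `u^(q*-r)`. -/
theorem integral_max_sub_rpow_le {q r L : ℝ} (hq : 1 < q) (hqN : q < N) (hqr : q ≤ r)
    (hr : r ≤ critExp N q) (hL : 0 < L) {u : E N → ℝ} (hu : MemW1 q u) :
    ∫ x, max (u x - L) 0 ^ r ≤ L ^ (-(critExp N q - r)) * ∫ x, |u x| ^ critExp N q := by
  rw [← integral_const_mul]
  refine integral_mono (integrable_max_sub_rpow hq hqN hqr hr hu hL.le)
    ((hu.integrable_abs_rpow hq.le hqN (lt_critExp hq.le hqN).le le_rfl).const_mul _) fun x => ?_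
  dsimp only
  by_cases h1 : u x - L ≤ 0
  · rw [max_eq_right h1, Real.zero_rpow (by linarith)]
    positivity
  have h2 : L < u x := by linarith
  have hu0 : 0 < u x := hL.trans h2
  rw [max_eq_left (by linarith), abs_of_pos hu0, Real.rpow_neg hL.le, inv_mul_eq_div,
    le_div_iff₀ (by positivity)]
  calc (u x - L) ^ r * L ^ (critExp N q - r) ≤ u x ^ r * u x ^ (critExp N q - r) := by
        have h3 : (u x - L) ^ r ≤ u x ^ r :=
          Real.rpow_le_rpow (by linarith) (by linarith) (by linarith)
        have h4 : L ^ (critExp N q - r) ≤ u x ^ (critExp N q - r) :=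
          Real.rpow_le_rpow hL.le h2.le (by linarith)
        gcongr
    _ = u x ^ critExp N q := by rw [← Real.rpow_add hu0]; ring_nf

/-! ### Uniform bound and uniform decay -/

/-- Solutions converging in `W^{1,q}` are bounded by a common constant. -/
theorem exists_uniform_bound {p q r V₀ C : ℝ} (hp : 1 < p) (hpq : p < q) (hqN : q < N)
    (hqr : q < r) (hr : r < critExp N q) (hV₀ : 0 < V₀) (hC : 0 < C) {f : ℝ → ℝ}
    (hfc : Continuous f) (hf : ∀ t : ℝ, 0 < t → |f t| ≤ V₀ * t ^ (p - 1) + C * t ^ (r - 1))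
    {V : ℕ → E N → ℝ} (hVm : ∀ n, Measurable (V n)) (hV : ∀ n x, V₀ ≤ V n x)
    {v : ℕ → E N → ℝ} (hv : ∀ n, IsPositiveWeakSolution p q (V n) f (v n))
    {w : E N → ℝ} (hw : MemW1 q w) (h : Tendsto (fun n => w1Norm q (v n - w)) atTop (𝓝 0)) :
    ∃ M : ℝ, 0 < M ∧ ∀ n, ∀ᵐ x, v n x ≤ M := by
  have hq := hp.trans hpq
  -- The cutoffs will be constantly `1`, so `K = 0`. The threshold must not depend on the level,
  -- which is still to be chosen large; `κ₀ = 1` provides this.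
  obtain ⟨τ, hτ, hthr⟩ := exists_deGiorgi_threshold hp hpq hqN hqr hr.le hV₀ hC hfc hf
    (K := 0) (κ₀ := 1) le_rfl one_pos
  obtain ⟨B, hB0, hB⟩ := exists_integral_critExp_bound hq.le hqN (fun n => (hv n).mem.memW1_q) hw h
  have hlim := (tendsto_rpow_neg_atTop (y := critExp N q - r) (by linarith)).mul_const B
  rw [zero_mul] at hlim
  obtain ⟨L, h1, h2⟩ := ((hlim.eventually (ge_mem_nhds hτ)).and (eventually_ge_atTop 1)).exists
  refine ⟨2 * L, by linarith, fun n => ?_⟩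
  have hu := (hv n).mem.memW1_q
  have h3 := hthr (V n) (hVm n) (hV n) (v n) (hv n) (fun _ _ => 1)
    (fun j => by rw [zero_mul]; exact isCutoff_const_one) (fun _ _ _ => rfl) (2 * L) (by linarith) (by
      rw [mul_div_cancel_left₀ L two_ne_zero]
      refine (setIntegral_le_integral (integrable_max_sub_rpow hq hqN hqr.le hr.le hu (by linarith))
        (Eventually.of_forall fun x => by simp only [Pi.zero_apply]; positivity)).trans ?_
      refine (integral_max_sub_rpow_le hq hqN hqr.le hr.le (by linarith) hu).trans (le_trans ?_ h1)
      gcongr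
      exact hB n)
  filter_upwards [h3] with x hx
  exact hx fun _ => one_pos

/-- Solutions converging in `W^{1,q}` decay uniformly at infinity. -/
theorem exists_uniform_decay {p q r V₀ C : ℝ} (hp : 1 < p) (hpq : p < q) (hqN : q < N)
    (hqr : q < r) (hr : r < critExp N q) (hV₀ : 0 < V₀) (hC : 0 < C) {f : ℝ → ℝ}
    (hfc : Continuous f) (hf : ∀ t : ℝ, 0 < t → |f t| ≤ V₀ * t ^ (p - 1) + C * t ^ (r - 1))
    {V : ℕ → E N → ℝ} (hVm : ∀ n, Measurable (V n)) (hV : ∀ n x, V₀ ≤ V n x)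
    {v : ℕ → E N → ℝ} (hv : ∀ n, IsPositiveWeakSolution p q (V n) f (v n))
    {w : E N → ℝ} (hw : MemW1 q w) (h : Tendsto (fun n => w1Norm q (v n - w)) atTop (𝓝 0))
    {ε : ℝ} (hε : 0 < ε) :
    ∃ R : ℝ, 0 < R ∧ ∀ n, ∀ᵐ x : E N, R ≤ ‖x‖ → v n x ≤ ε := by
  have hq := hp.trans hpq
  obtain ⟨K, hK, hcut⟩ := exists_exterior_cutoffs (N := N) hq
  -- Here the level `ε` is fixed and `τ` is obtained before `R`: the cutoff constant `K` serves all
  -- `R ≥ 1`, so `R` can be taken large enough for the tail to fall below `τ`.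
  obtain ⟨τ, hτ, hthr⟩ := exists_deGiorgi_threshold hp hpq hqN hqr hr.le hV₀ hC hfc hf hK hε
  obtain ⟨R, hR, htail⟩ := exists_uniform_tail hq.le hqN hqr.le hr.le
    (fun n => (hv n).mem.memW1_q) hw h hτ
  obtain ⟨ζ, hζ, hnest, hsupp, hpos⟩ := hcut R hR
  refine ⟨2 * R, by linarith, fun n => ?_⟩
  have hu := (hv n).mem.memW1_q
  have hi := hu.integrable_abs_rpow hq.le hqN hqr.le hr.le
  have h3 := hthr (V n) (hVm n) (hV n) (v n) (hv n) ζ hζ hnest ε le_rfl (by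
    refine le_trans ?_ (htail n)
    refine (integral_mono (integrable_max_sub_rpow hq hqN hqr.le hr.le hu
      (by linarith)).integrableOn hi.integrableOn fun x => ?_).trans
      (setIntegral_mono_set hi.integrableOn (Eventually.of_forall fun x => by
        simp only [Pi.zero_apply]; positivity) (Eventually.of_forall fun x hx => hsupp x hx))
    exact Real.rpow_le_rpow (le_max_right _ _) (max_sub_le_abs (by linarith)) (by linarith))
  filter_upwards [h3] with x hx hxR
  exact hx fun j => hpos j x hxR

end PQLaplace

theorem lemma7p1 (N : ℕ) (p q : ℝ) (hp : 1 < p) (hpq : p < q) (hqN : q < N)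
    (f : ℝ → ℝ) (hf : PQLaplace.Nonlinearity N p q f)
    (V₀ : ℝ) (hV₀ : 0 < V₀)
    (V : ℕ → PQLaplace.E N → ℝ) (hVm : ∀ n, Measurable (V n)) (hV : ∀ n x, V₀ ≤ V n x)
    (v : ℕ → PQLaplace.E N → ℝ)
    (hv : ∀ n, PQLaplace.IsPositiveWeakSolution p q (V n) f (v n))
    (vlim : PQLaplace.E N → ℝ)
    (hlim_p : PQLaplace.MemW1 p vlim) (hlim_q : PQLaplace.MemW1 q vlim)
    (hlim_ne : ¬ vlim =ᵐ[volume] 0)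
    (htendsto_p : Tendsto (fun n => PQLaplace.w1Norm p (v n - vlim)) atTop (𝓝 0))
    (htendsto_q : Tendsto (fun n => PQLaplace.w1Norm q (v n - vlim)) atTop (𝓝 0)) :
    (∀ n, MemLp (v n) ∞ volume) ∧
    (∃ C : ℝ, 0 < C ∧ ∀ n, eLpNorm (v n) ∞ volume ≤ ENNReal.ofReal C) ∧
    (∀ ε : ℝ, 0 < ε → ∃ R : ℝ, 0 < R ∧ ∀ n, ∀ᵐ x ∂(volume : Measure (PQLaplace.E N)),
      R ≤ ‖x‖ → |v n x| ≤ ε) := by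
  have hq := hp.trans hpq
  obtain ⟨r, hqr, hr, hinf⟩ := hf.subcritical
  obtain ⟨C, hC, hgr⟩ := PQLaplace.exists_growth_bound (p := p) (hq.trans hqr) hf.continuous
    hf.lim_zero hinf hV₀
  obtain ⟨M, hM, hbd⟩ := PQLaplace.exists_uniform_bound hp hpq hqN hqr hr hV₀ hC hf.continuous hgr
    hVm hV hv hlim_q htendsto_q
  have hnorm : ∀ n, eLpNorm (v n) ∞ volume ≤ ENNReal.ofReal M := fun n => by
    rw [eLpNorm_exponent_top]
    refine eLpNormEssSup_le_of_ae_bound ?_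
    filter_upwards [hbd n, (hv n).pos] with x h1 h2
    rwa [Real.norm_of_nonneg h2.le]
  refine ⟨fun n => ⟨(hv n).mem.memW1_q.memLp.1, (hnorm n).trans_lt ENNReal.ofReal_lt_top⟩,
    ⟨M, hM, hnorm⟩, fun ε hε => ?_⟩
  obtain ⟨R, hR, hdec⟩ := PQLaplace.exists_uniform_decay hp hpq hqN hqr hr hV₀ hC hf.continuous hgr
    hVm hV hv hlim_q htendsto_q hε
  refine ⟨R, hR, fun n => ?_⟩
  filter_upwards [hdec n, (hv n).pos] with x h1 h2 hx
  rw [abs_of_pos h2]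
  exact h1 hx
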